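/- **Setting.** Let $d\ge 0$, $l_0,T\ge 1$ be integers, $\varepsilon\ge 0$, $\lambda>0$, $L\ge\sqrt\lambda$, $R\ge 0$, and let $\theta_\star\in\mathbb R^d$ satisfy $\|\theta_\star\|_2\le H$. On a probability space with a filtration $(\mathcal F_t)_{t\ge 0}$, in each round $t=1,\dots,T$ an (arbitrary, possibly random) arm set $\mathcal X_t\subset\mathbb R^d$ is given, all of whose elements satisfy $\|x\|_2\le L$; an $\mathcal F_{t-1}$-measurable arm $x_t\in\mathcal X_t$ is played and the reward $r_t=x_t^\top\theta_\star+z_t$ is received, where $z_t$ is $\mathcal F_t$-measurable and conditionally $R$-subgaussian: $\mathbb E[e^{a z_t}\mid\mathcal F_{t-1}]\le e^{a^2R^2/2}$ almost surely for all $a\in\mathbb R$. The regret is $\mathrm{Regret}_T=\sum_{t=1}^T\bigl(\sup_{x\in\mathcal X_t}x^\top\theta_\star-x_t^\top\theta_\star\bigr)$. **Frequent Directions (FD).** A sketch of size $l$ is an $l\times d$ matrix, initially $0$. To update it with a row $x$, write $x$ into its last row, take a singular value decomposition $U\Sigma V^\top$ with singular values $\sigma_1\ge\dots\ge\sigma_l\ge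 0$, and replace the sketch by $\sqrt{\Sigma^2-\sigma_l^2 I}\,V^\top$; $\sigma_l^2$ is the shrinking value. **Dyadic Block Sketching.** Rows are distributed to consecutive blocks $0,1,\dots,B$, where block $i$ carries an FD sketch $S_i$ of size $l_i=2^il_0$, and block $B$ is active; initially $B=0$ and block $0$ is empty. The size of a block is the sum of $\|x\|_2^2$ over its rows. On a row $x$: (i) if $B\ge\lfloor\log_2(d/l_0+1)\rfloor-1$ (the sketch is saturated), put $S^\top S\leftarrow S^\top S+xx^\top$; (ii) otherwise, if with $x$ included the size of the active block would exceed $\varepsilon l_0$ and the rank of its rows would be at least $l_B$, open a new empty block (so $B\leftarrow B+1$); then update the FD sketch of the active block with $x$, and let $S$ be the matrix formed by stacking $S_0,\dots,S_B$. Let $B_t$ be the value of $B$ and $S^{(t)}$ the matrix $S$ after $t$ rounds, let $\bar\sigma^{(t)}$ be the sum of all shrinking values so far, and let $k_t=2l_{B_t}$ if the sketch is not saturated after $t$ rounds and $k_t=\max\{2l_{B_t},d\}$ if it is. **DBSLinUCB.** With $\delta=1/T$, put $\hat A^{(t)}=(S^{(t)})^\top S^{(t)}+\lambda I$, $\hat\theta_t=(\hat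 A^{(t)})^{-1}\sum_{s\le t}r_sx_s$ and $$\hat\beta_t=R\sqrt{1+\tfrac{\bar\sigma^{(t)}}\lambda}\sqrt{2\ln\tfrac1\delta+d\ln\Bigl(1+\tfrac{\bar\sigma^{(t)}}\lambda\Bigr)+k_t\ln\Bigl(1+\tfrac{tL^2}{k_t\lambda}\Bigr)}+H\,\frac{\lambda+\bar\sigma^{(t)}}{\sqrt\lambda}.$$ In round $t$ the algorithm plays some $x_t\in\arg\max_{x\in\mathcal X_t}\bigl\{x^\top\hat\theta_{t-1}+\hat\beta_{t-1}\sqrt{x^\top(\hat A^{(t-1)})^{-1}x}\bigr\}$ and updates the sketch with $x_t$. **Theorem.** There is an absolute constant $C>0$ such that in every such setting, with probability at least $1-\frac1T$, DBSLinUCB using FD satisfies $$\mathrm{Regret}_T\le C\cdot\frac{L(R+H\sqrt\lambda)}{\sqrt\lambda}\left(d\ln\Bigl(1+\frac\varepsilon\lambda\Bigr)+2l_{B_T}\ln\Bigl(1+\frac{TL^2}{2l_{B_T}\lambda}\Bigr)\right)\Bigl(1+\frac\varepsilon\lambda\Bigr)^{3/2}\sqrt T,$$ where $l_{B_T}=2^{B_T}l_0$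 is the sketch size of the final active block. -/

import Mathlib

open MeasureTheory

noncomputable section

namespace DBSLinUCB

/-- The arm space `ℝ^d` with its Euclidean norm. -/
abbrev E (d : ℕ) : Type := EuclideanSpace ℝ (Fin d)

/-- A (thin) singular value decomposition `A = U · diag s · W` of an `l × d` matrix: `U` is
orthogonal, the rows of `W = Vᵀ` are orthonormal, the singular values `s` are nonnegative and in
descending order. -/
def IsSVD {l d : ℕ} (A : Matrix (Fin l) (Fin d) ℝ) (U : Matrix (Fin l) (Fin l) ℝ)
    (s : Fin l → ℝ) (W : Matrix (Fin l) (Fin d) ℝ) : Prop :=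
  U ∈ Matrix.orthogonalGroup (Fin l) ℝ ∧ W * W.transpose = 1 ∧ Antitone s ∧ (∀ i, 0 ≤ s i) ∧
    A = U * Matrix.diagonal s * W

/-- One Frequent Directions update of the sketch `S` with the row `x`: write `x` into the last row
of `S`, take any singular value decomposition, and shrink all squared singular values by the
square `σ` of the last one. The result is `S'`, the shrinking value is `σ`. -/
def FDUpdate {l d : ℕ} (S : Matrix (Fin l) (Fin d) ℝ) (x : E d) (σ : ℝ)
    (S' : Matrix (Fin l) (Fin d) ℝ) : Prop :=
  ∃ (last : Fin l) (U : Matrix (Fin l) (Fin l) ℝ) (s : Fin l → ℝ) (W : Matrix (Fin l) (Fin d) ℝ),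
    (last : ℕ) + 1 = l ∧ IsSVD (S.updateRow last x.ofLp) U s W ∧ σ = s last ^ 2 ∧
      S' = Matrix.diagonal (fun i => √(s i ^ 2 - σ)) * W

/-- State of Dyadic Block Sketching with initial sketch size `l₀`; block `i` has sketch size
`2 ^ i * l₀`. -/
structure State (d l₀ : ℕ) where
  /-- index of the active block; the blocks are `0, …, B` -/
  B : ℕ
  /-- the rows covered by the active block -/
  rows : List (E d)
  /-- the sketch matrix of each block -/
  sketch : (i : ℕ) → Matrix (Fin (2 ^ i * l₀)) (Fin d) ℝ
  /-- the sum of the shrinking values of each block -/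
  shrink : ℕ → ℝ
  /-- the sketched covariance matrix `Sᵀ S` of the whole stream -/
  gram : Matrix (Fin d) (Fin d) ℝ

namespace State

variable {d l₀ : ℕ}

/-- One empty block of sketch size `l₀`. -/
def init (d l₀ : ℕ) : State d l₀ where
  B := 0
  rows := []
  sketch := fun _ => 0
  shrink := fun _ => 0
  gram := 0

/-- The sketch size of the active block. -/
def length (st : State d l₀) : ℕ := 2 ^ st.B * l₀

/-- The size of the active block: the sum of the squared norms of the rows it covers. -/
def size (st : State d l₀) : ℝ := (st.rows.map fun y => ‖y‖ ^ 2).sum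

/-- The rank of the rows of the active block together with the incoming row `x`. -/
def rankWith (st : State d l₀) (x : E d) : ℕ :=
  Module.finrank ℝ (Submodule.span ℝ {y | y ∈ x :: st.rows})

/-- The sum of the shrinking values over all blocks. -/
def totalShrink (st : State d l₀) : ℝ := ∑ i ∈ Finset.range (st.B + 1), st.shrink i

/-- The sketches of all blocks stacked on top of each other. -/
def stacked (st : State d l₀) :
    Matrix (Σ i : Fin (st.B + 1), Fin (2 ^ (i : ℕ) * l₀)) (Fin d) ℝ :=
  fun p => st.sketch p.1 p.2

/-- The maximal number of blocks is reached: from now on the covariance matrix is updated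
exactly. -/
def Saturated (st : State d l₀) : Prop :=
  ⌊Real.logb 2 ((d : ℝ) / (l₀ : ℝ) + 1)⌋ - 1 ≤ (st.B : ℤ)

/-- Close the active block and open an empty one of twice the sketch size. -/
def openBlock (st : State d l₀) : State d l₀ :=
  { st with
    B := st.B + 1
    rows := []
    sketch := Function.update st.sketch (st.B + 1) 0
    shrink := Function.update st.shrink (st.B + 1) 0 }

open Classical in
/-- If the size of the active block would exceed `ε l₀` with the row `x` and its sketch size
does not exceed the rank of its rows with `x` included, open a new block. -/
def prepare (ε : ℝ) (st : State d l₀) (x : E d) : State d l₀ :=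
  if ε * (l₀ : ℝ) < st.size + ‖x‖ ^ 2 ∧ st.length ≤ st.rankWith x then st.openBlock else st

/-- Put the row `x` into the active block, whose sketch becomes `S'` with shrinking value `σ`. -/
def insert (st : State d l₀) (x : E d) (σ : ℝ) (S' : Matrix (Fin (2 ^ st.B * l₀)) (Fin d) ℝ) :
    State d l₀ :=
  { st with
    rows := x :: st.rows
    sketch := Function.update st.sketch st.B S'
    shrink := Function.update st.shrink st.B (st.shrink st.B + σ) }

/-- Recompute the covariance matrix from the stacked sketches. -/
def combine (st : State d l₀) : State d l₀ :=
  { st with gram := st.stacked.transpose * st.stacked }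

/-- One round of Dyadic Block Sketching with Frequent Directions, on the row `x`. -/
def Step (ε : ℝ) (st : State d l₀) (x : E d) (st' : State d l₀) : Prop :=
  (st.Saturated ∧ st' = { st with gram := st.gram + Matrix.vecMulVec x.ofLp x.ofLp }) ∨
  (¬ st.Saturated ∧ ∃ (σ : ℝ) (S' : Matrix (Fin (2 ^ (st.prepare ε x).B * l₀)) (Fin d) ℝ),
    FDUpdate ((st.prepare ε x).sketch (st.prepare ε x).B) x σ S' ∧
      st' = ((st.prepare ε x).insert x σ S').combine)

open Classical in
/-- Upper bound for the rank of the sketched covariance matrix: twice the sketch size of the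
active block while all rows are sketched; once rows are added exactly, at least `d`. -/
def rankBound (st : State d l₀) : ℕ :=
  if st.Saturated then max (2 * st.length) d else 2 * st.length

/-- The regularized sketched covariance matrix `Â = Sᵀ S + lam I`. -/
def covariance (lam : ℝ) (st : State d l₀) : Matrix (Fin d) (Fin d) ℝ :=
  st.gram + lam • (1 : Matrix (Fin d) (Fin d) ℝ)

/-- The confidence radius after `t` rounds. -/
def radius (lam L H R δ : ℝ) (t : ℕ) (st : State d l₀) : ℝ :=
  R * √(1 + st.totalShrink / lam) *
      √(2 * Real.log (1 / δ) + d * Real.log (1 + st.totalShrink / lam) +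
        st.rankBound * Real.log (1 + t * L ^ 2 / (st.rankBound * lam))) +
    H * ((lam + st.totalShrink) / √lam)

end State

variable {d l₀ : ℕ}

/-- The sketched regularized least squares estimate after `t` rounds. -/
def estimate (lam : ℝ) (st : State d l₀) (t : ℕ) (x : ℕ → E d) (r : ℕ → ℝ) : E d :=
  WithLp.toLp 2 ((st.covariance lam)⁻¹.mulVec (∑ s ∈ Finset.range t, r s • x s).ofLp)

/-- The weighted norm `‖y‖_M = √(yᵀ M y)`. -/
def weightedNorm (M : Matrix (Fin d) (Fin d) ℝ) (y : E d) : ℝ :=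
  √(dotProduct y.ofLp (M.mulVec y.ofLp))

/-- The index maximized by the algorithm when `t` rounds have been played. -/
def ucb (lam L H R δ : ℝ) (st : State d l₀) (t : ℕ) (x : ℕ → E d) (r : ℕ → ℝ) (y : E d) : ℝ :=
  inner ℝ y (estimate lam st t x r) +
    st.radius lam L H R δ t * weightedNorm (st.covariance lam)⁻¹ y

/-- `T` rounds of DBSLinUCB with Frequent Directions on the arm sets `𝒳 0, …, 𝒳 (T - 1)`: `x t` is
the arm played and `r t` the reward received in round `t + 1`, and `st t` is the state of the
sketch after `t` rounds. -/
structure IsRun (ε lam L H R δ : ℝ) (T : ℕ) (𝒳 : ℕ → Set (E d)) (x : ℕ → E d) (r : ℕ → ℝ)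
    (st : ℕ → State d l₀) : Prop where
  init : st 0 = State.init d l₀
  mem : ∀ t < T, x t ∈ 𝒳 t
  select : ∀ t < T, IsMaxOn (ucb lam L H R δ (st t) t x r) (𝒳 t) (x t)
  step : ∀ t < T, (st t).Step ε (x t) (st (t + 1))

/-- The regret over `T` rounds. -/
def regret (T : ℕ) (𝒳 : ℕ → Set (E d)) (x : ℕ → E d) (θ : E d) : ℝ :=
  ∑ t ∈ Finset.range T, ((⨆ y : 𝒳 t, inner ℝ (y : E d) θ) - inner ℝ (x t) θ)

/-- `z` is conditionally `R`-subgaussian given the σ-algebra `m`. -/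
def CondSubgaussian {Ω : Type*} (m : MeasurableSpace Ω) [mΩ : MeasurableSpace Ω] (μ : Measure Ω)
    (R : ℝ) (z : Ω → ℝ) : Prop :=
  ∀ a : ℝ, Integrable (fun ω => Real.exp (a * z ω)) μ ∧
    μ[fun ω => Real.exp (a * z ω) | m] ≤ᵐ[μ] fun _ => Real.exp (a ^ 2 * R ^ 2 / 2)

end DBSLinUCB

end

/-! The proof runs the optimism analysis of linear bandits on a covariance matrix known only up to a
spectral error of at most `2 * ε`.

Sketching error. One FD update loses between `0` and `σ I` of covariance, and the trace drops by
exactly `l * σ`. Hence `l_i` times the shrinkage of block `i` is at most the size of that block. A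
block grows beyond `ε * l₀` only while its rows have rank below `l_i`, and then nothing is shrunk.
So block `i` contributes at most `ε / 2 ^ i`, and all blocks together at most `2 * ε`
(`SketchInv.insert`, `GramInv.step`).

Confidence. Let `V_t` be the exact regularized covariance. The error bound gives `V_t ≤ (1 + σ̄ / λ)
Â_t`, so norms for `Â_t⁻¹` and `V_t⁻¹` are comparable. A Gaussian mixture supermartingale and
Ville's inequality control the noise in the `V_t⁻¹` norm for all `t ≤ T` at once
(`measure_selfNormalized_le`). The same comparison bounds `log det V_t`, where the sketch enters
only through its number of rows. The sketching bias is measured against `λ I ≤ Â_t`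
(`abs_inner_estimate_sub_le`).

Regret. Optimism bounds each round by twice the radius times `‖x_t‖` in the `Â⁻¹` norm. Passing to
`V⁻¹`, Cauchy–Schwarz and the elliptical potential lemma sum the rounds. With `u = 1 + ε / λ`, the
radius contributes a factor `u` and the change of norm a factor `√u`, which is the exponent `3 / 2`.
-/

noncomputable section

namespace DBSLinUCB

/-! ### Quadratic forms, inverses and determinants of positive definite matrices. -/

section LinearAlgebra

open Matrix

variable {ι : Type*} [Fintype ι]

theorem dotProduct_mulVec_comm_of_isHermitian {A : Matrix ι ι ℝ} (hA : A.IsHermitian)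
    (u v : ι → ℝ) : u ⬝ᵥ A *ᵥ v = v ⬝ᵥ A *ᵥ u := by
  have hT : Aᵀ = A := by simpa [IsHermitian, conjTranspose_eq_transpose_of_trivial] using hA
  rw [dotProduct_mulVec, ← mulVec_transpose, hT, dotProduct_comm]

theorem quadForm_nonneg {A : Matrix ι ι ℝ} (hA : A.PosSemidef) (u : ι → ℝ) :
    0 ≤ u ⬝ᵥ A *ᵥ u := by
  simpa using hA.dotProduct_mulVec_nonneg u

theorem posSemidef_of_quadForm_nonneg {A : Matrix ι ι ℝ} (hA : A.IsHermitian)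
    (h : ∀ u, 0 ≤ u ⬝ᵥ A *ᵥ u) : A.PosSemidef :=
  .of_dotProduct_mulVec_nonneg hA fun u => by simpa using h u

theorem quadForm_add {A : Matrix ι ι ℝ} (hA : A.IsHermitian) (u v : ι → ℝ) :
    (u + v) ⬝ᵥ A *ᵥ (u + v) = u ⬝ᵥ A *ᵥ u + 2 * (u ⬝ᵥ A *ᵥ v) + v ⬝ᵥ A *ᵥ v := by
  rw [mulVec_add, add_dotProduct, dotProduct_add, dotProduct_add,
    dotProduct_mulVec_comm_of_isHermitian hA v u]
  ring

theorem quadForm_smul (A : Matrix ι ι ℝ) (c : ℝ) (u : ι → ℝ) :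
    (c • u) ⬝ᵥ A *ᵥ (c • u) = c ^ 2 * (u ⬝ᵥ A *ᵥ u) := by
  rw [mulVec_smul, smul_dotProduct, dotProduct_smul, smul_eq_mul, smul_eq_mul]
  ring

/-- The Cauchy–Schwarz inequality for a positive semidefinite form. -/
theorem sq_dotProduct_mulVec_le {A : Matrix ι ι ℝ} (hA : A.PosSemidef) (u v : ι → ℝ) :
    (u ⬝ᵥ A *ᵥ v) ^ 2 ≤ (u ⬝ᵥ A *ᵥ u) * (v ⬝ᵥ A *ᵥ v) := by
  have h : ∀ c : ℝ, 0 ≤ (u ⬝ᵥ A *ᵥ u) * (c * c) + (2 * (u ⬝ᵥ A *ᵥ v)) * c + v ⬝ᵥ A *ᵥ v := by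
    intro c
    have := quadForm_nonneg hA (c • u + v)
    rw [quadForm_add hA.isHermitian, quadForm_smul, smul_dotProduct, smul_eq_mul] at this
    linarith
  have := discrim_le_zero h
  rw [discrim] at this
  linarith

theorem abs_dotProduct_mulVec_le {A : Matrix ι ι ℝ} (hA : A.PosSemidef) (u v : ι → ℝ) :
    |u ⬝ᵥ A *ᵥ v| ≤ √(u ⬝ᵥ A *ᵥ u) * √(v ⬝ᵥ A *ᵥ v) := by
  rw [← Real.sqrt_mul (quadForm_nonneg hA u)]
  exact Real.abs_le_sqrt (sq_dotProduct_mulVec_le hA u v)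

/-- The triangle inequality for the seminorm of a positive semidefinite form. -/
theorem sqrt_quadForm_add_le {A : Matrix ι ι ℝ} (hA : A.PosSemidef) (u v : ι → ℝ) :
    √((u + v) ⬝ᵥ A *ᵥ (u + v)) ≤ √(u ⬝ᵥ A *ᵥ u) + √(v ⬝ᵥ A *ᵥ v) := by
  rw [Real.sqrt_le_left (by positivity), quadForm_add hA.isHermitian, add_sq,
    Real.sq_sqrt (quadForm_nonneg hA u), Real.sq_sqrt (quadForm_nonneg hA v)]
  have := (le_abs_self _).trans (abs_dotProduct_mulVec_le hA u v)
  linarith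

theorem quadForm_transpose_mul_self {κ : Type*} [Fintype κ] (S : Matrix κ ι ℝ) (v : ι → ℝ) :
    v ⬝ᵥ (Sᵀ * S) *ᵥ v = (S *ᵥ v) ⬝ᵥ (S *ᵥ v) := by
  rw [← mulVec_mulVec, dotProduct_mulVec, vecMul_transpose]

theorem quadForm_vecMulVec (x v : ι → ℝ) : v ⬝ᵥ (vecMulVec x x) *ᵥ v = (x ⬝ᵥ v) ^ 2 := by
  rw [vecMulVec_mulVec, dotProduct_smul, dotProduct_comm v x]
  simp [sq]

theorem posSemidef_vecMulVec_self (x : ι → ℝ) : (vecMulVec x x).PosSemidef := by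
  simpa using posSemidef_vecMulVec_self_star x

theorem posSemidef_transpose_mul_self {κ : Type*} [Fintype κ] (S : Matrix κ ι ℝ) :
    (Sᵀ * S).PosSemidef := by
  simpa using posSemidef_conjTranspose_mul_self S

theorem posSemidef_mul_transpose_self {κ : Type*} [Fintype κ] (S : Matrix ι κ ℝ) :
    (S * Sᵀ).PosSemidef := by
  simpa using posSemidef_self_mul_conjTranspose S

theorem posDef_add_vecMulVec {A : Matrix ι ι ℝ} (hA : A.PosDef) (x : ι → ℝ) :
    (A + vecMulVec x x).PosDef :=
  hA.add_posSemidef (posSemidef_vecMulVec_self x)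

variable [DecidableEq ι]

theorem mulVec_inv_mulVec {A : Matrix ι ι ℝ} (hA : A.PosDef) (y : ι → ℝ) :
    A *ᵥ A⁻¹ *ᵥ y = y := by
  rw [mulVec_mulVec, mul_nonsing_inv _ ((isUnit_iff_isUnit_det _).1 hA.isUnit), one_mulVec]

theorem inv_mulVec_mulVec {A : Matrix ι ι ℝ} (hA : A.PosDef) (y : ι → ℝ) :
    A⁻¹ *ᵥ A *ᵥ y = y := by
  rw [mulVec_mulVec, nonsing_inv_mul _ ((isUnit_iff_isUnit_det _).1 hA.isUnit), one_mulVec]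

theorem quadForm_inv_mulVec {A : Matrix ι ι ℝ} (hA : A.PosDef) (y : ι → ℝ) :
    (A⁻¹ *ᵥ y) ⬝ᵥ A *ᵥ (A⁻¹ *ᵥ y) = y ⬝ᵥ A⁻¹ *ᵥ y := by
  rw [mulVec_inv_mulVec hA, dotProduct_comm]

/-- The quadratic form of the inverse is the convex conjugate of the quadratic form. -/
theorem two_mul_dotProduct_sub_le {A : Matrix ι ι ℝ} (hA : A.PosDef) (u y : ι → ℝ) :
    2 * (u ⬝ᵥ y) - u ⬝ᵥ A *ᵥ u ≤ y ⬝ᵥ A⁻¹ *ᵥ y := by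
  have h := quadForm_nonneg hA.posSemidef (u + (-1 : ℝ) • (A⁻¹ *ᵥ y))
  rw [quadForm_add hA.isHermitian, quadForm_smul, quadForm_inv_mulVec hA, mulVec_smul,
    dotProduct_smul, mulVec_inv_mulVec hA, smul_eq_mul] at h
  linarith

/-- Inversion reverses the Loewner order. -/
theorem quadForm_inv_le_of_le {A B : Matrix ι ι ℝ} (hA : A.PosDef) (hB : B.PosDef) {c : ℝ}
    (hc : 0 < c) (h : ∀ u, u ⬝ᵥ A *ᵥ u ≤ c * (u ⬝ᵥ B *ᵥ u)) (y : ι → ℝ) :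
    y ⬝ᵥ B⁻¹ *ᵥ y ≤ c * (y ⬝ᵥ A⁻¹ *ᵥ y) := by
  -- The conjugate bound for `A` is tested at the maximizer for `c B`, namely `c⁻¹ B⁻¹ y`.
  have h1 := two_mul_dotProduct_sub_le hA (c⁻¹ • (B⁻¹ *ᵥ y)) y
  have h2 := h (B⁻¹ *ᵥ y)
  rw [quadForm_smul, smul_dotProduct, smul_eq_mul, dotProduct_comm _ y] at h1
  rw [quadForm_inv_mulVec hB] at h2
  set q := y ⬝ᵥ B⁻¹ *ᵥ y
  have h3 : c⁻¹ ^ 2 * ((B⁻¹ *ᵥ y) ⬝ᵥ A *ᵥ (B⁻¹ *ᵥ y)) ≤ c⁻¹ ^ 2 * (c * q) := by gcongr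
  have h4 : c⁻¹ ^ 2 * (c * q) = c⁻¹ * q := by field_simp
  have h5 : c⁻¹ * q ≤ y ⬝ᵥ A⁻¹ *ᵥ y := by linarith
  calc q = c * (c⁻¹ * q) := by field_simp
    _ ≤ _ := by gcongr

theorem quadForm_inv_le_of_smul_le {B : Matrix ι ι ℝ} (hB : B.PosDef) {c : ℝ} (hc : 0 < c)
    (h : ∀ u, c * (u ⬝ᵥ u) ≤ u ⬝ᵥ B *ᵥ u) (y : ι → ℝ) :
    y ⬝ᵥ B⁻¹ *ᵥ y ≤ (y ⬝ᵥ y) / c := by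
  have h2 := h (B⁻¹ *ᵥ y)
  rw [quadForm_inv_mulVec hB] at h2
  have h1 : 0 ≤ (y - c • (B⁻¹ *ᵥ y)) ⬝ᵥ (y - c • (B⁻¹ *ᵥ y)) :=
    Finset.sum_nonneg fun i _ => mul_self_nonneg _
  simp only [sub_dotProduct, dotProduct_sub, smul_dotProduct, dotProduct_smul, smul_eq_mul,
    dotProduct_comm _ y] at h1
  rw [le_div_iff₀ hc]
  nlinarith [mul_le_mul_of_nonneg_left h2 hc.le]

/-- The matrix determinant lemma. It drives both the mixture supermartingale and the elliptical
potential. -/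
theorem det_add_vecMulVec {A : Matrix ι ι ℝ} (hA : A.PosDef) (x : ι → ℝ) :
    (A + vecMulVec x x).det = A.det * (1 + x ⬝ᵥ A⁻¹ *ᵥ x) := by
  have := det_add_replicateCol_mul_replicateRow (ι := Unit)
    ((isUnit_iff_isUnit_det _).1 hA.isUnit) x x
  rw [← vecMulVec_eq] at this
  rw [this, det_unique (n := Unit), dotProduct_mulVec]
  congr 1

/-- A consequence of the Sherman–Morrison formula. -/
theorem quadForm_inv_add_vecMulVec {A : Matrix ι ι ℝ} (hA : A.PosDef) (x s : ι → ℝ) (z : ℝ) :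
    (s + z • x) ⬝ᵥ (A + vecMulVec x x)⁻¹ *ᵥ (s + z • x) =
      s ⬝ᵥ A⁻¹ *ᵥ s + (z ^ 2 * (x ⬝ᵥ A⁻¹ *ᵥ x) + 2 * z * (x ⬝ᵥ A⁻¹ *ᵥ s)
        - (x ⬝ᵥ A⁻¹ *ᵥ s) ^ 2) / (1 + x ⬝ᵥ A⁻¹ *ᵥ x) := by
  have hw : 0 ≤ x ⬝ᵥ A⁻¹ *ᵥ x := quadForm_nonneg hA.inv.posSemidef x
  have hsym := dotProduct_mulVec_comm_of_isHermitian hA.inv.isHermitian s x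
  set w := x ⬝ᵥ A⁻¹ *ᵥ x with hwdef
  set a := x ⬝ᵥ A⁻¹ *ᵥ s with hadef
  -- With the ansatz `A⁻¹ s + c A⁻¹ x`, the coefficients of `x` agree iff `a + c (1 + w) = z`.
  have key : (A + vecMulVec x x)⁻¹ *ᵥ (s + z • x) =
      A⁻¹ *ᵥ s + ((z - a) / (1 + w)) • (A⁻¹ *ᵥ x) := by
    have h1 : (A + vecMulVec x x) *ᵥ (A⁻¹ *ᵥ s + ((z - a) / (1 + w)) • (A⁻¹ *ᵥ x)) =
        s + z • x := by
      rw [add_mulVec, mulVec_add, mulVec_add, mulVec_smul, mulVec_smul, mulVec_inv_mulVec hA,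
        mulVec_inv_mulVec hA, vecMulVec_mulVec, vecMulVec_mulVec, ← hwdef, ← hadef]
      ext i
      simp
      field_simp
      ring
    rw [← h1, inv_mulVec_mulVec (posDef_add_vecMulVec hA x)]
  rw [key, add_dotProduct, dotProduct_add, dotProduct_add, dotProduct_smul, dotProduct_smul,
    smul_dotProduct, smul_dotProduct, ← hwdef, ← hadef, hsym]
  simp only [smul_eq_mul]
  field_simp
  ring

theorem det_le_det_add_sum_vecMulVec {A : Matrix ι ι ℝ} (hA : A.PosDef) {κ : Type*}
    (x : κ → ι → ℝ) (s : Finset κ) : A.det ≤ (A + ∑ i ∈ s, vecMulVec (x i) (x i)).det := by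
  classical
  induction s using Finset.induction_on with
  | empty => simp
  | insert a s ha ih =>
    have hP : (A + ∑ i ∈ s, vecMulVec (x i) (x i)).PosDef :=
      hA.add_posSemidef (posSemidef_sum s fun i _ => posSemidef_vecMulVec_self (x i))
    rw [Finset.sum_insert ha, add_comm (vecMulVec _ _), ← add_assoc, det_add_vecMulVec hP]
    have := quadForm_nonneg hP.inv.posSemidef (x a)
    nlinarith [hP.det_pos]

open scoped MatrixOrder Matrix.Norms.L2Operator in
-- The difference factors as `Qᴴ Q`, a sum of rank-one terms, and each of them multiplies the
-- determinant by a factor at least `1`.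
theorem det_le_det_of_le {A B : Matrix ι ι ℝ} (hA : A.PosDef) (hB : B.IsHermitian)
    (h : ∀ u, u ⬝ᵥ A *ᵥ u ≤ u ⬝ᵥ B *ᵥ u) : A.det ≤ B.det := by
  have hD : (B - A).PosSemidef := posSemidef_of_quadForm_nonneg (hB.sub hA.isHermitian) fun u => by
    rw [sub_mulVec, dotProduct_sub]
    linarith [h u]
  obtain ⟨Q, hQ⟩ := CStarAlgebra.nonneg_iff_eq_star_mul_self.mp hD.nonneg
  rw [star_eq_conjTranspose] at hQ
  have hsum : Qᴴ * Q = ∑ i, vecMulVec (Q i) (Q i) := by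
    ext i j
    simp [Matrix.mul_apply, Matrix.sum_apply, vecMulVec_apply]
  have := det_le_det_add_sum_vecMulVec hA Q Finset.univ
  rwa [← hsum, ← hQ, add_sub_cancel] at this

/-- The inequality of arithmetic and geometric means for the eigenvalues. -/
theorem log_det_le {M : Matrix ι ι ℝ} (hM : M.PosDef) :
    Real.log M.det ≤ Fintype.card ι * Real.log (M.trace / Fintype.card ι) := by
  have hH := hM.isHermitian
  have hdet : M.det = ∏ i, hH.eigenvalues i := by simpa using hH.det_eq_prod_eigenvalues
  have htr : M.trace = ∑ i, hH.eigenvalues i := by simpa using hH.trace_eq_sum_eigenvalues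
  have hpos : ∀ i, 0 < hH.eigenvalues i := hM.eigenvalues_pos
  rcases isEmpty_or_nonempty ι with h | h
  · simp
  have hn : (0 : ℝ) < Fintype.card ι := by exact_mod_cast Fintype.card_pos
  have htp : 0 < M.trace := by rw [htr]; exact Finset.sum_pos (fun i _ => hpos i) Finset.univ_nonempty
  set m := M.trace / Fintype.card ι with hm
  have hmp : 0 < m := by positivity
  rw [hdet, Real.log_prod fun i _ => (hpos i).ne']
  -- The tangent of the concave logarithm at the mean `m`; its linear parts sum to zero.
  calc ∑ i, Real.log (hH.eigenvalues i)
      ≤ ∑ i, (Real.log m + (hH.eigenvalues i / m - 1)) := Finset.sum_le_sum fun i _ => by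
        have := Real.log_le_sub_one_of_pos (div_pos (hpos i) hmp)
        rw [Real.log_div (hpos i).ne' hmp.ne'] at this
        linarith
    _ = Fintype.card ι * Real.log m := by
        rw [Finset.sum_add_distrib, Finset.sum_sub_distrib, ← Finset.sum_div, ← htr]
        simp only [Finset.sum_const, Finset.card_univ, nsmul_eq_mul, mul_one]
        have : M.trace / m = Fintype.card ι := by rw [hm]; field_simp
        rw [this]; ring

theorem log_det_one_add_le {G : Matrix ι ι ℝ} (hG : G.PosSemidef) :
    Real.log (1 + G).det ≤ Fintype.card ι * Real.log (1 + G.trace / Fintype.card ι) := by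
  refine (log_det_le (PosDef.one.add_posSemidef hG)).trans_eq ?_
  rcases isEmpty_or_nonempty ι with h | h
  · simp
  have hn : (0 : ℝ) < Fintype.card ι := by exact_mod_cast Fintype.card_pos
  rw [trace_add, trace_one, add_div, div_self hn.ne']

end LinearAlgebra

/-- Bernoulli's inequality with exponent `k' / k ≥ 1`. It allows a dimension in a log-determinant
bound to be replaced by any larger number. -/
theorem mul_log_one_add_div_le {a k k' : ℝ} (ha : 0 ≤ a) (hk : 0 ≤ k) (hkk : k ≤ k') :
    k * Real.log (1 + a / k) ≤ k' * Real.log (1 + a / k') := by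
  -- For `k = 0` the left side is `0`, as division by zero gives `0`.
  rcases hk.eq_or_lt with rfl | hk
  · simpa using mul_nonneg hkk (Real.log_nonneg (by simpa using div_nonneg ha hkk))
  have hk' : 0 < k' := hk.trans_le hkk
  have h1 : 1 ≤ k' / k := (one_le_div hk).2 hkk
  have h2 := one_add_mul_self_le_rpow_one_add (s := a / k') (by linarith [div_nonneg ha hk'.le]) h1
  have h3 : k' / k * (a / k') = a / k := by field_simp
  rw [h3] at h2
  have h4 : Real.log (1 + a / k) ≤ k' / k * Real.log (1 + a / k') := by
    rw [← Real.log_rpow (by positivity)]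
    exact Real.log_le_log (by positivity) h2
  calc k * Real.log (1 + a / k) ≤ k * (k' / k * Real.log (1 + a / k')) := by gcongr
    _ = _ := by field_simp

/-! ### Frequent Directions and the error of Dyadic Block Sketching. -/

section Sketch

open Matrix

theorem dotProduct_self_eq_sum_sq {κ : Type*} [Fintype κ] (v : κ → ℝ) : v ⬝ᵥ v = ∑ i, v i ^ 2 := by
  simp [dotProduct, sq]

theorem dotProduct_self_nonneg {κ : Type*} [Fintype κ] (v : κ → ℝ) : 0 ≤ v ⬝ᵥ v :=
  Finset.sum_nonneg fun _ _ => mul_self_nonneg _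

theorem dotProduct_ofLp_self {d : ℕ} (x : E d) : x.ofLp ⬝ᵥ x.ofLp = ‖x‖ ^ 2 := by
  rw [EuclideanSpace.real_norm_sq_eq, dotProduct_self_eq_sum_sq]

theorem inner_eq_dotProduct {d : ℕ} (x y : E d) : inner ℝ x y = x.ofLp ⬝ᵥ y.ofLp := by
  rw [EuclideanSpace.inner_eq_star_dotProduct, dotProduct_comm]
  simp

/-- The Bessel inequality for a matrix with orthonormal rows. -/
theorem dotProduct_mulVec_self_le {l d : ℕ} {W : Matrix (Fin l) (Fin d) ℝ} (hW : W * Wᵀ = 1)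
    (v : Fin d → ℝ) : (W *ᵥ v) ⬝ᵥ (W *ᵥ v) ≤ v ⬝ᵥ v := by
  have h := dotProduct_self_nonneg (v - Wᵀ *ᵥ (W *ᵥ v))
  have h1 : v ⬝ᵥ Wᵀ *ᵥ (W *ᵥ v) = (W *ᵥ v) ⬝ᵥ (W *ᵥ v) := by
    rw [dotProduct_mulVec, vecMul_transpose]
  have h2 : (Wᵀ *ᵥ (W *ᵥ v)) ⬝ᵥ (Wᵀ *ᵥ (W *ᵥ v)) = (W *ᵥ v) ⬝ᵥ (W *ᵥ v) := by
    rw [dotProduct_mulVec, vecMul_transpose, mulVec_mulVec _ W, hW, one_mulVec]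
  rw [sub_dotProduct, dotProduct_sub, dotProduct_sub, h2, dotProduct_comm (Wᵀ *ᵥ _) v, h1] at h
  linarith

theorem trace_transpose_mul_self {l d : ℕ} (S : Matrix (Fin l) (Fin d) ℝ) :
    (Sᵀ * S).trace = ∑ i, S i ⬝ᵥ S i := by
  rw [trace_mul_comm]
  simp [trace, Matrix.mul_apply, dotProduct]

theorem sum_updateRow {l d : ℕ} (S : Matrix (Fin l) (Fin d) ℝ) {last : Fin l} (hS : S last = 0)
    (x : Fin d → ℝ) (f : (Fin d → ℝ) → ℝ) (hf : f 0 = 0) :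
    ∑ i, f (S.updateRow last x i) = ∑ i, f (S i) + f x := by
  classical
  rw [← Finset.add_sum_erase _ _ (Finset.mem_univ last),
    ← Finset.add_sum_erase _ (fun i => f (S i)) (Finset.mem_univ last), updateRow_self, hS, hf,
    zero_add, add_comm]
  congr 1
  exact Finset.sum_congr rfl fun i hi => by rw [updateRow_ne (Finset.ne_of_mem_erase hi)]

theorem IsSVD.mulVec_dotProduct_self {l d : ℕ} {A : Matrix (Fin l) (Fin d) ℝ}
    {U : Matrix (Fin l) (Fin l) ℝ} {s : Fin l → ℝ} {W : Matrix (Fin l) (Fin d) ℝ}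
    (h : IsSVD A U s W) (v : Fin d → ℝ) :
    (A *ᵥ v) ⬝ᵥ (A *ᵥ v) = ∑ i, s i ^ 2 * (W *ᵥ v) i ^ 2 := by
  obtain ⟨hU, -, -, -, rfl⟩ := h
  have hU' : Uᵀ * U = 1 := by simpa using (mem_orthogonalGroup_iff' (Fin l) ℝ).1 hU
  rw [← mulVec_mulVec, ← mulVec_mulVec, dotProduct_mulVec, ← mulVec_transpose, mulVec_mulVec,
    hU', one_mulVec, dotProduct_self_eq_sum_sq]
  simp [mulVec_diagonal, mul_pow]

theorem IsSVD.sum_dotProduct {l d : ℕ} {A : Matrix (Fin l) (Fin d) ℝ}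
    {U : Matrix (Fin l) (Fin l) ℝ} {s : Fin l → ℝ} {W : Matrix (Fin l) (Fin d) ℝ}
    (h : IsSVD A U s W) : ∑ i, A i ⬝ᵥ A i = ∑ i, s i ^ 2 := by
  obtain ⟨hU, hW, -, -, rfl⟩ := h
  have hU' : Uᵀ * U = 1 := by simpa using (mem_orthogonalGroup_iff' (Fin l) ℝ).1 hU
  rw [← trace_transpose_mul_self, trace_mul_comm, transpose_mul, transpose_mul, Matrix.mul_assoc,
    Matrix.mul_assoc, ← Matrix.mul_assoc W, hW, Matrix.one_mul, trace_mul_comm, Matrix.mul_assoc,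
    Matrix.mul_assoc, hU', Matrix.mul_one, diagonal_transpose, diagonal_mul_diagonal,
    trace_diagonal]
  simp [sq]

theorem IsSVD.sub_sq_last_nonneg {l d : ℕ} {A : Matrix (Fin l) (Fin d) ℝ}
    {U : Matrix (Fin l) (Fin l) ℝ} {s : Fin l → ℝ} {W : Matrix (Fin l) (Fin d) ℝ}
    (h : IsSVD A U s W) {last : Fin l} (hl : (last : ℕ) + 1 = l) (i : Fin l) :
    0 ≤ s i ^ 2 - s last ^ 2 := by
  have : s last ≤ s i := h.2.2.1 (Fin.le_def.2 (by omega))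
  have := pow_le_pow_left₀ (h.2.2.2.1 last) this 2
  linarith

/-- The properties of a Frequent Directions update used in the analysis. -/
theorem FDUpdate.properties {l d : ℕ} {S S' : Matrix (Fin l) (Fin d) ℝ} {x : E d} {σ : ℝ}
    (h : FDUpdate S x σ S') (hS : ∀ i : Fin l, (i : ℕ) + 1 = l → S i = 0) :
    0 ≤ σ ∧ (∀ i : Fin l, (i : ℕ) + 1 = l → S' i = 0) ∧
    (∀ v, (S' *ᵥ v) ⬝ᵥ (S' *ᵥ v) ≤ (S *ᵥ v) ⬝ᵥ (S *ᵥ v) + (x.ofLp ⬝ᵥ v) ^ 2) ∧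
    (∀ v, (S *ᵥ v) ⬝ᵥ (S *ᵥ v) + (x.ofLp ⬝ᵥ v) ^ 2 ≤ (S' *ᵥ v) ⬝ᵥ (S' *ᵥ v) + σ * (v ⬝ᵥ v)) ∧
    (S'ᵀ * S').trace + l * σ = (Sᵀ * S).trace + ‖x‖ ^ 2 := by
  obtain ⟨last, U, s, W, hl, hsvd, rfl, rfl⟩ := h
  have hnn := hsvd.sub_sq_last_nonneg hl
  have hrow : ∀ i, (diagonal (fun i => √(s i ^ 2 - s last ^ 2)) * W) i =
      √(s i ^ 2 - s last ^ 2) • W i := fun i => by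
    ext j
    simp [diagonal_mul]
  have hmul : ∀ v, (S *ᵥ v) ⬝ᵥ (S *ᵥ v) + (x.ofLp ⬝ᵥ v) ^ 2 =
      ∑ i, s i ^ 2 * (W *ᵥ v) i ^ 2 := fun v => by
    rw [← hsvd.mulVec_dotProduct_self, dotProduct_self_eq_sum_sq, dotProduct_self_eq_sum_sq]
    exact (sum_updateRow S (hS last hl) x.ofLp (fun r => (r ⬝ᵥ v) ^ 2) (by simp)).symm
  -- Shrinking removes exactly `σ WᵀW`, and `0 ≤ WᵀW ≤ I` by Bessel's inequality; this yields both
  -- sides of the energy bound.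
  have hmul' : ∀ v, ((diagonal (fun i => √(s i ^ 2 - s last ^ 2)) * W) *ᵥ v) ⬝ᵥ
      ((diagonal (fun i => √(s i ^ 2 - s last ^ 2)) * W) *ᵥ v) =
      ∑ i, s i ^ 2 * (W *ᵥ v) i ^ 2 - s last ^ 2 * ((W *ᵥ v) ⬝ᵥ (W *ᵥ v)) := fun v => by
    rw [← mulVec_mulVec, dotProduct_self_eq_sum_sq, dotProduct_self_eq_sum_sq, Finset.mul_sum,
      ← Finset.sum_sub_distrib]
    refine Finset.sum_congr rfl fun i _ => ?_
    rw [mulVec_diagonal, mul_pow, Real.sq_sqrt (hnn i)]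
    ring
  refine ⟨sq_nonneg _, fun i hi => ?_, fun v => ?_, fun v => ?_, ?_⟩
  -- The last singular value is shrunk to zero, so the next row can be written there without loss.
  · have : i = last := Fin.ext (by omega)
    rw [hrow, this]
    simp
  · rw [hmul, hmul']
    have := mul_nonneg (sq_nonneg (s last)) (dotProduct_self_nonneg (W *ᵥ v))
    linarith
  · rw [hmul, hmul']
    have := mul_le_mul_of_nonneg_left (dotProduct_mulVec_self_le hsvd.2.1 v) (sq_nonneg (s last))
    linarith
  · have hWW : ∀ i, W i ⬝ᵥ W i = 1 := fun i => by
      simpa [Matrix.mul_apply, dotProduct] using congrFun (congrFun hsvd.2.1 i) i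
    have h1 : (Sᵀ * S).trace + ‖x‖ ^ 2 = ∑ i, s i ^ 2 := by
      rw [← hsvd.sum_dotProduct, trace_transpose_mul_self, ← dotProduct_ofLp_self]
      exact (sum_updateRow S (hS last hl) x.ofLp (fun r => r ⬝ᵥ r) (by simp)).symm
    rw [h1, trace_transpose_mul_self]
    have h2 : ∀ i, (diagonal (fun i => √(s i ^ 2 - s last ^ 2)) * W) i ⬝ᵥ
        (diagonal (fun i => √(s i ^ 2 - s last ^ 2)) * W) i = s i ^ 2 - s last ^ 2 := fun i => by
      rw [hrow, smul_dotProduct, dotProduct_smul, hWW, smul_eq_mul, smul_eq_mul, mul_one,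
        Real.mul_self_sqrt (hnn i)]
    simp [h2]

/-- The sketch is not shrunk as long as the rows span a space of dimension less than its size. -/
theorem FDUpdate.eq_zero_of_finrank_lt {l d : ℕ} {S S' : Matrix (Fin l) (Fin d) ℝ} {x : E d}
    {σ : ℝ} (h : FDUpdate S x σ S') (hS : ∀ i : Fin l, (i : ℕ) + 1 = l → S i = 0)
    (K : Submodule ℝ (E d)) (hx : x ∈ K) (hK : ∀ v ∈ Kᗮ, S *ᵥ v.ofLp = 0)
    (hl : Module.finrank ℝ K < l) : σ = 0 := by
  obtain ⟨last, U, s, W, hlast, hsvd, rfl, rfl⟩ := h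
  -- If `σ` were nonzero, all `l` singular values would be positive, so all `l` orthonormal right
  -- singular vectors would lie in `K`, whose dimension is too small.
  by_contra hne
  have hpos : ∀ i, 0 < s i ^ 2 := fun i => by
    have := hsvd.sub_sq_last_nonneg hlast i
    have := lt_of_le_of_ne (sq_nonneg (s last)) (Ne.symm hne)
    linarith
  have hmem : ∀ i, WithLp.toLp 2 (W i) ∈ K := fun i => by
    rw [← K.orthogonal_orthogonal, Submodule.mem_orthogonal]
    intro v hv
    -- A vector orthogonal to `K` is annihilated by the sketch and by the new row.
    have h0 : ∑ i, s i ^ 2 * (W *ᵥ v.ofLp) i ^ 2 = 0 := by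
      rw [← hsvd.mulVec_dotProduct_self, dotProduct_self_eq_sum_sq]
      refine (sum_updateRow S (hS last hlast) x.ofLp (fun r => (r ⬝ᵥ v.ofLp) ^ 2) (by simp)).trans ?_
      have h1 : x.ofLp ⬝ᵥ v.ofLp = 0 := by
        rw [← inner_eq_dotProduct]; exact Submodule.inner_right_of_mem_orthogonal hx hv
      have h2 : ∀ j, S j ⬝ᵥ v.ofLp = 0 := fun j => congrFun (hK v hv) j
      simp [h1, h2]
    have h1 := (Finset.sum_eq_zero_iff_of_nonneg fun i _ =>
      mul_nonneg (hpos i).le (sq_nonneg _)).1 h0 i (Finset.mem_univ i)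
    have h2 : (W *ᵥ v.ofLp) i = 0 := by
      simpa using (mul_eq_zero.1 h1).resolve_left (hpos i).ne'
    rw [inner_eq_dotProduct, dotProduct_comm]
    exact h2
  have hon : Orthonormal ℝ fun i => WithLp.toLp 2 (W i) := by
    rw [orthonormal_iff_ite]
    intro i j
    rw [inner_eq_dotProduct]
    simpa [Matrix.mul_apply, dotProduct, one_apply] using congrFun (congrFun hsvd.2.1 i) j
  have hli : LinearIndependent ℝ fun i => (⟨_, hmem i⟩ : K) :=
    LinearIndependent.of_comp K.subtype hon.linearIndependent
  have := hli.fintype_card_le_finrank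
  simp at this
  omega

/-! ### Invariants of the block structure. -/

variable {d l₀ : ℕ}

/-- The energy of the rows of the active block in the direction `v`. -/
def State.rowEnergy (st : State d l₀) (v : Fin d → ℝ) : ℝ :=
  (st.rows.map fun y => (y.ofLp ⬝ᵥ v) ^ 2).sum

/-- The energy of the sketch of block `i` in the direction `v`. -/
def State.sketchEnergy (st : State d l₀) (i : ℕ) (v : Fin d → ℝ) : ℝ :=
  (st.sketch i *ᵥ v) ⬝ᵥ (st.sketch i *ᵥ v)

/-- The invariant of Dyadic Block Sketching while rows are sketched; the first `t` rows of the
stream `x` have been processed. -/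
structure SketchInv (ε : ℝ) (x : ℕ → E d) (t : ℕ) (st : State d l₀) : Prop where
  last_eq_zero : ∀ i : Fin (2 ^ st.B * l₀), (i : ℕ) + 1 = 2 ^ st.B * l₀ → st.sketch st.B i = 0
  sketch_le : ∀ v, st.sketchEnergy st.B v ≤ st.rowEnergy v
  le_sketch : ∀ v, st.rowEnergy v ≤ st.sketchEnergy st.B v + st.shrink st.B * (v ⬝ᵥ v)
  trace_eq : ((st.sketch st.B)ᵀ * st.sketch st.B).trace + (2 ^ st.B * l₀ : ℕ) * st.shrink st.B =
    st.size
  closed_le : ∀ v, ∑ i ∈ Finset.range st.B, st.sketchEnergy i v + st.rowEnergy v ≤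
    ∑ s ∈ Finset.range t, ((x s).ofLp ⬝ᵥ v) ^ 2
  le_closed : ∀ v, ∑ s ∈ Finset.range t, ((x s).ofLp ⬝ᵥ v) ^ 2 ≤
    ∑ i ∈ Finset.range st.B, (st.sketchEnergy i v + st.shrink i * (v ⬝ᵥ v)) + st.rowEnergy v
  shrink_nonneg : ∀ i ≤ st.B, 0 ≤ st.shrink i
  shrink_le : ∀ i ≤ st.B, 2 ^ i * st.shrink i ≤ ε

theorem sketchInv_init {ε : ℝ} (hε : 0 ≤ ε) (x : ℕ → E d) :
    SketchInv ε x 0 (State.init d l₀) where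
  last_eq_zero i _ := rfl
  sketch_le v := by
    have h : (State.init d l₀).sketch (State.init d l₀).B = 0 := rfl
    rw [State.sketchEnergy, h, zero_mulVec, dotProduct_zero]
    simp [State.init, State.rowEnergy]
  le_sketch v := by
    have h : (State.init d l₀).sketch (State.init d l₀).B = 0 := rfl
    rw [State.sketchEnergy, h, zero_mulVec, dotProduct_zero]
    simp [State.init, State.rowEnergy]
  trace_eq := by
    have h : (State.init d l₀).sketch (State.init d l₀).B = 0 := rfl
    rw [h, Matrix.mul_zero, trace_zero]
    simp [State.init, State.size]
  closed_le v := by simp [State.init, State.rowEnergy]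
  le_closed v := by simp [State.init, State.rowEnergy]
  shrink_nonneg i _ := le_rfl
  shrink_le i _ := by simpa [State.init] using hε

theorem SketchInv.openBlock {ε : ℝ} (hε : 0 ≤ ε) {x : ℕ → E d} {t : ℕ} {st : State d l₀}
    (h : SketchInv ε x t st) : SketchInv ε x t st.openBlock := by
  have hs : st.openBlock.sketch (st.B + 1) = 0 := by simp [State.openBlock]
  have hsh : st.openBlock.shrink (st.B + 1) = 0 := by simp [State.openBlock]
  have hs' : ∀ i < st.B + 1, st.openBlock.sketch i = st.sketch i := fun i hi => by
    simp [State.openBlock, Function.update_of_ne hi.ne]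
  have hsh' : ∀ i < st.B + 1, st.openBlock.shrink i = st.shrink i := fun i hi => by
    simp [State.openBlock, Function.update_of_ne hi.ne]
  have he : ∀ i < st.B + 1, ∀ v, st.openBlock.sketchEnergy i v = st.sketchEnergy i v :=
    fun i hi v => by simp [State.sketchEnergy, hs' i hi]
  have he0 : ∀ v, st.openBlock.sketchEnergy (st.B + 1) v = 0 := fun v => by
    simp [State.sketchEnergy, hs]
  have hr : ∀ v, st.openBlock.rowEnergy v = 0 := fun v => by
    simp [State.openBlock, State.rowEnergy]
  refine ⟨fun i _ => ?_, fun v => ?_, fun v => ?_, ?_, fun v => ?_, fun v => ?_, fun i hi => ?_,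
    fun i hi => ?_⟩
  · exact congrFun hs i
  · exact (he0 v).le.trans (hr v).ge
  · rw [show st.openBlock.B = st.B + 1 from rfl, hr, he0, hsh]; simp
  · rw [show st.openBlock.B = st.B + 1 from rfl, hs, hsh]; simp [State.openBlock, State.size]
  · rw [show st.openBlock.B = st.B + 1 from rfl, hr, add_zero]
    rw [Finset.sum_congr rfl fun i hi => he i (Finset.mem_range.1 hi) v, Finset.sum_range_succ]
    linarith [h.closed_le v, h.sketch_le v]
  · rw [show st.openBlock.B = st.B + 1 from rfl, hr, add_zero]
    have hc : ∑ i ∈ Finset.range (st.B + 1),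
        (st.openBlock.sketchEnergy i v + st.openBlock.shrink i * (v ⬝ᵥ v)) =
        ∑ i ∈ Finset.range (st.B + 1), (st.sketchEnergy i v + st.shrink i * (v ⬝ᵥ v)) :=
      Finset.sum_congr rfl fun i hi => by
        rw [he i (Finset.mem_range.1 hi) v, hsh' i (Finset.mem_range.1 hi)]
    rw [hc, Finset.sum_range_succ]
    linarith [h.le_closed v, h.le_sketch v]
  · rcases (Nat.le_succ_iff.1 hi) with h1 | h1
    · rw [hsh' i (by omega)]; exact h.shrink_nonneg i h1
    · rw [h1]; exact hsh.ge
  · rcases (Nat.le_succ_iff.1 hi) with h1 | h1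
    · rw [hsh' i (by omega)]; exact h.shrink_le i h1
    · rw [h1]; exact (by rw [hsh, mul_zero] : _ = (0 : ℝ)).le.trans hε

theorem SketchInv.prepare {ε : ℝ} (hε : 0 ≤ ε) {x : ℕ → E d} {t : ℕ} {st : State d l₀}
    (h : SketchInv ε x t st) (y : E d) : SketchInv ε x t (st.prepare ε y) := by
  unfold State.prepare
  split_ifs
  exacts [h.openBlock hε, h]

theorem rankWith_prepare_lt {ε : ℝ} (hl₀ : 1 ≤ l₀) (st : State d l₀) (y : E d)
    (h : ε * (l₀ : ℝ) < (st.prepare ε y).size + ‖y‖ ^ 2) :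
    (st.prepare ε y).rankWith y < (st.prepare ε y).length := by
  unfold State.prepare at h ⊢
  split_ifs at h ⊢ with hc
  -- A fresh block holds only `y`, so the rank is at most `1`, while its sketch size has doubled to
  -- at least `2`.
  · have h1 : st.openBlock.rankWith y ≤ 1 := by
      have : {z | z ∈ y :: st.openBlock.rows} = {y} := by ext; simp [State.openBlock]
      rw [State.rankWith, this]
      exact (finrank_span_le_card ({y} : Set (E d))).trans (by simp)
    have h2 : 2 ≤ st.openBlock.length := by
      have : 1 ≤ 2 ^ st.B := Nat.one_le_two_pow
      simp only [State.openBlock, State.length, pow_succ]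
      nlinarith
    omega
  · by_contra hlt
    exact hc ⟨h, not_lt.1 hlt⟩

/-- The shrinkage bound rests on a dichotomy: either the block stays within size `ε * l₀` and the
trace identity bounds its shrinkage, or its rank is below the sketch size and this update shrinks
nothing. -/
theorem SketchInv.insert {ε : ℝ} (hl₀ : 1 ≤ l₀) {x : ℕ → E d} {t : ℕ} {st : State d l₀}
    (h : SketchInv ε x t st) {σ : ℝ} {S' : Matrix (Fin (2 ^ st.B * l₀)) (Fin d) ℝ}
    (hrank : ε * (l₀ : ℝ) < st.size + ‖x t‖ ^ 2 → st.rankWith (x t) < st.length)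
    (hFD : FDUpdate (st.sketch st.B) (x t) σ S') :
    SketchInv ε x (t + 1) (st.insert (x t) σ S') := by
  obtain ⟨hσ, hlast, hle, hge, htr⟩ := hFD.properties h.last_eq_zero
  set st' := st.insert (x t) σ S' with hst'
  have hs : st'.sketch st.B = S' := by simp [hst', State.insert]
  have hsh : st'.shrink st.B = st.shrink st.B + σ := by simp [hst', State.insert]
  have hs' : ∀ i < st.B, st'.sketch i = st.sketch i := fun i hi => by
    simp [hst', State.insert, Function.update_of_ne hi.ne]
  have hsh' : ∀ i < st.B, st'.shrink i = st.shrink i := fun i hi => by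
    simp [hst', State.insert, Function.update_of_ne hi.ne]
  have he : ∀ i < st.B, ∀ v, st'.sketchEnergy i v = st.sketchEnergy i v :=
    fun i hi v => by simp [State.sketchEnergy, hs' i hi]
  have heB : ∀ v, st'.sketchEnergy st.B v = (S' *ᵥ v) ⬝ᵥ (S' *ᵥ v) := fun v => by
    simp [State.sketchEnergy, hs]
  have hr : ∀ v, st'.rowEnergy v = st.rowEnergy v + ((x t).ofLp ⬝ᵥ v) ^ 2 := fun v => by
    simp [hst', State.insert, State.rowEnergy, add_comm]
  have hsize : st'.size = st.size + ‖x t‖ ^ 2 := by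
    simp [hst', State.insert, State.size, add_comm]
  have hB : st'.B = st.B := rfl
  have htr' : (S'ᵀ * S').trace + (2 ^ st.B * l₀ : ℕ) * (st.shrink st.B + σ) =
      st.size + ‖x t‖ ^ 2 := by
    have := h.trace_eq
    linarith
  have hl₀' : (0 : ℝ) < l₀ := by exact_mod_cast hl₀
  refine ⟨fun i hi => ?_, fun v => ?_, fun v => ?_, ?_, fun v => ?_, fun v => ?_, fun i hi => ?_,
    fun i hi => ?_⟩
  · exact (congrFun hs i).trans (hlast i hi)
  · rw [hB, heB, hr]
    exact (hle v).trans (add_le_add_left (h.sketch_le v) _)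
  · rw [hB, heB, hr, hsh]
    have := h.le_sketch v
    have := hge v
    unfold State.sketchEnergy at *
    linarith
  · rw [hB, hs, hsh, hsize, htr']
  · rw [hB, hr, Finset.sum_congr rfl fun i hi => he i (Finset.mem_range.1 hi) v,
      Finset.sum_range_succ _ t]
    linarith [h.closed_le v]
  · have hc : ∑ i ∈ Finset.range st.B, (st'.sketchEnergy i v + st'.shrink i * (v ⬝ᵥ v)) =
        ∑ i ∈ Finset.range st.B, (st.sketchEnergy i v + st.shrink i * (v ⬝ᵥ v)) :=
      Finset.sum_congr rfl fun i hi => by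
        rw [he i (Finset.mem_range.1 hi) v, hsh' i (Finset.mem_range.1 hi)]
    rw [hB, hr, hc, Finset.sum_range_succ _ t]
    linarith [h.le_closed v]
  · rcases (lt_or_eq_of_le hi) with h1 | h1
    · rw [hsh' i h1]; exact h.shrink_nonneg i hi
    · rw [h1, hB, hsh]; exact add_nonneg (h.shrink_nonneg _ le_rfl) hσ
  · rcases (lt_or_eq_of_le hi) with h1 | h1
    · rw [hsh' i h1]; exact h.shrink_le i hi
    rw [h1, hB, hsh]
    rcases lt_or_ge (ε * (l₀ : ℝ)) (st.size + ‖x t‖ ^ 2) with hbig | hsmall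
    · have : σ = 0 := by
        refine hFD.eq_zero_of_finrank_lt h.last_eq_zero
          (Submodule.span ℝ {y | y ∈ x t :: st.rows}) (Submodule.subset_span (by simp)) ?_
          (hrank hbig)
        intro v hv
        have h0 : st.rowEnergy v.ofLp = 0 := by
          refine List.sum_eq_zero fun a ha => ?_
          obtain ⟨y, hy, rfl⟩ := List.mem_map.1 ha
          rw [← inner_eq_dotProduct, Submodule.inner_right_of_mem_orthogonal
            (Submodule.subset_span (by simp [hy])) hv]
          simp
        have h1 := h.sketch_le v.ofLp
        rw [h0] at h1
        -- The sketch never has more energy than the rows, so directions orthogonal to the rows are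
        -- null for it.
        exact dotProduct_self_eq_zero.1 (le_antisymm h1 (dotProduct_self_nonneg _))
      rw [this, add_zero]
      exact h.shrink_le _ le_rfl
    -- Dropping the nonnegative trace leaves `2 ^ B * l₀ * shrink ≤ size ≤ ε * l₀`; then `l₀` is
    -- cancelled.
    · have hp : 0 ≤ (S'ᵀ * S').trace := (posSemidef_transpose_mul_self S').trace_nonneg
      push_cast at htr'
      refine le_of_mul_le_mul_right ?_ hl₀'
      linarith

/-- The invariant of Dyadic Block Sketching: the sketched covariance matrix differs from the one
of the first `t` rows of the stream `x` by at most the sum of the shrinking values. -/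
structure GramInv (ε : ℝ) (x : ℕ → E d) (t : ℕ) (st : State d l₀) : Prop where
  posSemidef : st.gram.PosSemidef
  gram_le : ∀ v, v ⬝ᵥ st.gram *ᵥ v ≤ ∑ s ∈ Finset.range t, ((x s).ofLp ⬝ᵥ v) ^ 2
  le_gram : ∀ v, ∑ s ∈ Finset.range t, ((x s).ofLp ⬝ᵥ v) ^ 2 ≤
    v ⬝ᵥ st.gram *ᵥ v + st.totalShrink * (v ⬝ᵥ v)
  shrink_nonneg : 0 ≤ st.totalShrink
  shrink_le : st.totalShrink ≤ 2 * ε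
  gram_eq : ¬ st.Saturated → st.gram = st.stackedᵀ * st.stacked ∧ SketchInv ε x t st

theorem stacked_energy (st : State d l₀) (v : Fin d → ℝ) :
    v ⬝ᵥ (st.stackedᵀ * st.stacked) *ᵥ v =
      ∑ i ∈ Finset.range (st.B + 1), st.sketchEnergy i v := by
  rw [quadForm_transpose_mul_self, dotProduct, Fintype.sum_sigma, Finset.sum_range]
  rfl

theorem sum_range_le_two_mul {ε : ℝ} (n : ℕ) (f : ℕ → ℝ) (h : ∀ i < n, 2 ^ i * f i ≤ ε)
    (hε : 0 ≤ ε) : ∑ i ∈ Finset.range n, f i ≤ 2 * ε := by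
  calc ∑ i ∈ Finset.range n, f i ≤ ∑ i ∈ Finset.range n, (1 / 2 : ℝ) ^ i * ε := by
        refine Finset.sum_le_sum fun i hi => ?_
        have := h i (Finset.mem_range.1 hi)
        rw [one_div, inv_pow, inv_mul_eq_div, le_div_iff₀ (by positivity)]
        linarith
    _ ≤ 2 * ε := by
        rw [← Finset.sum_mul]
        exact mul_le_mul_of_nonneg_right (sum_geometric_two_le n) hε

theorem SketchInv.gramInv {ε : ℝ} (hε : 0 ≤ ε) {x : ℕ → E d} {t : ℕ} {st : State d l₀}
    (h : SketchInv ε x t st) (hg : st.gram = st.stackedᵀ * st.stacked) : GramInv ε x t st where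
  posSemidef := hg ▸ posSemidef_transpose_mul_self _
  gram_le v := by
    rw [hg, stacked_energy, Finset.sum_range_succ]
    linarith [h.closed_le v, h.sketch_le v]
  le_gram v := by
    have h1 := h.le_closed v
    rw [Finset.sum_add_distrib, ← Finset.sum_mul] at h1
    rw [hg, stacked_energy, Finset.sum_range_succ, State.totalShrink, Finset.sum_range_succ]
    linarith [h.le_sketch v]
  shrink_nonneg := Finset.sum_nonneg fun i hi => h.shrink_nonneg i (by simp at hi; omega)
  shrink_le := sum_range_le_two_mul _ _ (fun i hi => h.shrink_le i (by omega)) hε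
  gram_eq _ := ⟨hg, h⟩

theorem gramInv_init {ε : ℝ} (hε : 0 ≤ ε) (x : ℕ → E d) : GramInv ε x 0 (State.init d l₀) :=
  (sketchInv_init hε x).gramInv hε <| by
    have : (State.init d l₀).stacked = 0 := rfl
    rw [this, Matrix.mul_zero]
    rfl

theorem GramInv.step {ε : ℝ} (hε : 0 ≤ ε) (hl₀ : 1 ≤ l₀) {x : ℕ → E d} {t : ℕ}
    {st st' : State d l₀} (h : GramInv ε x t st) (hst : st.Step ε (x t) st') :
    GramInv ε x (t + 1) st' := by
  rcases hst with ⟨hsat, rfl⟩ | ⟨hsat, σ, S', hFD, rfl⟩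
  -- An exact rank-one update adds the same term to both covariances and leaves the error unchanged.
  · refine ⟨h.posSemidef.add (posSemidef_vecMulVec_self _), fun v => ?_, fun v => ?_,
      h.shrink_nonneg, h.shrink_le, fun hns => (hns hsat).elim⟩
    · dsimp only
      rw [add_mulVec, dotProduct_add, quadForm_vecMulVec, Finset.sum_range_succ]
      linarith [h.gram_le v]
    · have := h.le_gram v
      simp only [State.totalShrink] at this ⊢
      rw [add_mulVec, dotProduct_add, quadForm_vecMulVec, Finset.sum_range_succ]
      linarith
  · have h1 := ((h.gram_eq hsat).2.prepare hε (x t)).insert hl₀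
      (rankWith_prepare_lt hl₀ st (x t)) hFD
    -- `combine` changes only `gram`, which no field of the invariant mentions.
    have h2 : SketchInv ε x (t + 1) (((st.prepare ε (x t)).insert (x t) σ S').combine) :=
      ⟨h1.1, h1.2, h1.3, h1.4, h1.5, h1.6, h1.7, h1.8⟩
    exact h2.gramInv hε rfl

theorem Step.B_le {ε : ℝ} {y : E d} {st st' : State d l₀} (hst : st.Step ε y st') :
    st.B ≤ st'.B ∧ (st.Saturated → st'.B = st.B) := by
  rcases hst with ⟨hsat, rfl⟩ | ⟨hsat, σ, S', hFD, rfl⟩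
  · exact ⟨le_rfl, fun _ => rfl⟩
  · refine ⟨?_, fun h => (hsat h).elim⟩
    change st.B ≤ (st.prepare ε y).B
    unfold State.prepare
    split_ifs
    exacts [Nat.le_succ _, le_rfl]

/-- Saturation means `log₂ (d / l₀ + 1) < B + 2`. Thus the bound `max (2 l_B) d` on the rank stays
within a factor two of `2 l_B`. -/
theorem le_four_mul_length_of_saturated (hl₀ : 1 ≤ l₀) {st : State d l₀} (h : st.Saturated) :
    d ≤ 4 * st.length := by
  have hl₀' : (0 : ℝ) < l₀ := by exact_mod_cast hl₀
  have h0 : (0 : ℝ) < (d : ℝ) / l₀ + 1 := by positivity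
  have h1 : Real.logb 2 ((d : ℝ) / l₀ + 1) < ((st.B + 2 : ℕ) : ℝ) := by
    have : (⌊Real.logb 2 ((d : ℝ) / l₀ + 1)⌋ : ℤ) < ((st.B + 2 : ℕ) : ℤ) := by
      unfold State.Saturated at h
      push_cast
      omega
    exact_mod_cast Int.floor_lt.1 this
  rw [Real.logb_lt_iff_lt_rpow one_lt_two h0, Real.rpow_natCast] at h1
  have h2 : (d : ℝ) / l₀ < 2 ^ (st.B + 2) := by linarith
  rw [div_lt_iff₀ hl₀'] at h2
  have h3 : d < 2 ^ (st.B + 2) * l₀ := by exact_mod_cast h2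
  rw [State.length]
  rw [pow_add] at h3
  nlinarith

end Sketch

/-! ### Ville's inequality and one step of the Gaussian mixture. -/

section Mixture

open ProbabilityTheory

/-- Completing the square in `u`: up to a factor free of `u`, the product is again a Gaussian
density, with variance `1 / (1 + b²)`. -/
theorem exp_mul_gaussianPDFReal (a b z u : ℝ) :
    Real.exp ((a + b * u) * z - (a + b * u) ^ 2 / 2) * gaussianPDFReal 0 1 u =
      (√(1 + b ^ 2))⁻¹ *
        Real.exp ((b ^ 2 * z ^ 2 + 2 * a * z - a ^ 2) / (2 * (1 + b ^ 2))) *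
        gaussianPDFReal (b * (z - a) / (1 + b ^ 2)) (Real.toNNReal (1 + b ^ 2)⁻¹) u := by
  have hb : 0 < 1 + b ^ 2 := by positivity
  rw [gaussianPDFReal_def, gaussianPDFReal_def]
  simp only [Real.coe_toNNReal _ (inv_pos.2 hb).le, NNReal.coe_one, mul_one]
  have h1 : (√(1 + b ^ 2))⁻¹ * (√(2 * Real.pi * (1 + b ^ 2)⁻¹))⁻¹ = (√(2 * Real.pi))⁻¹ := by
    rw [← mul_inv, ← Real.sqrt_mul hb.le]
    congr 2
    field_simp
  have h2 : Real.exp ((a + b * u) * z - (a + b * u) ^ 2 / 2) * Real.exp (-(u - 0) ^ 2 / 2) =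
      Real.exp ((b ^ 2 * z ^ 2 + 2 * a * z - a ^ 2) / (2 * (1 + b ^ 2))) *
        Real.exp (-(u - b * (z - a) / (1 + b ^ 2)) ^ 2 / (2 * (1 + b ^ 2)⁻¹)) := by
    rw [← Real.exp_add, ← Real.exp_add]
    congr 1
    field_simp
    ring
  rw [← h1]
  linear_combination (√(1 + b ^ 2))⁻¹ * (√(2 * Real.pi * (1 + b ^ 2)⁻¹))⁻¹ * h2

/-- A Gaussian mixture of the exponentials `exp (v z - v² / 2)`. -/
theorem lintegral_exp_mul_gaussianPDF {w : ℝ} (hw : 0 ≤ w) (a z : ℝ) :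
    ∫⁻ u, ENNReal.ofReal (Real.exp ((a + √w * u) * z - (a + √w * u) ^ 2 / 2)) *
        gaussianPDF 0 1 u =
      ENNReal.ofReal ((√(1 + w))⁻¹ *
        Real.exp ((w * z ^ 2 + 2 * a * z - a ^ 2) / (2 * (1 + w)))) := by
  have h : ∀ u, ENNReal.ofReal (Real.exp ((a + √w * u) * z - (a + √w * u) ^ 2 / 2)) *
        gaussianPDF 0 1 u = ENNReal.ofReal ((√(1 + w))⁻¹ *
        Real.exp ((w * z ^ 2 + 2 * a * z - a ^ 2) / (2 * (1 + w)))) *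
        gaussianPDF (√w * (z - a) / (1 + w)) (Real.toNNReal (1 + w)⁻¹) u := fun u => by
    have := exp_mul_gaussianPDFReal a (√w) z u
    rw [Real.sq_sqrt hw] at this
    rw [gaussianPDF, gaussianPDF, ← ENNReal.ofReal_mul (by positivity), this,
      ← ENNReal.ofReal_mul (by positivity)]
  simp_rw [h]
  rw [lintegral_const_mul _ (measurable_gaussianPDF _ _), lintegral_gaussianPDF_eq_one, mul_one]
  have : 0 < (1 + w)⁻¹ := by positivity
  simpa using by linarith

variable {Ω : Type*} {m mΩ : MeasurableSpace Ω} {μ : Measure Ω} {z : Ω → ℝ}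

/-- The maximal inequality of Ville for a nonnegative supermartingale with finite horizon. -/
theorem mul_measure_exists_lt_le (ℱ : Filtration ℕ mΩ) {T : ℕ} {M : ℕ → Ω → ENNReal}
    (hM : ∀ t ≤ T, Measurable[ℱ t] (M t))
    (hsuper : ∀ t < T, ∀ s, MeasurableSet[ℱ t] s → ∫⁻ ω in s, M (t + 1) ω ∂μ ≤ ∫⁻ ω in s, M t ω ∂μ)
    (h0 : ∫⁻ ω, M 0 ω ∂μ ≤ 1) (c : ENNReal) :
    c * μ {ω | ∃ t ≤ T, c < M t ω} ≤ 1 := by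
  have hmeas : ∀ t ≤ T, MeasurableSet[ℱ t] {ω | ∃ s ≤ t, c < M s ω} := fun t ht => by
    have : {ω | ∃ s ≤ t, c < M s ω} = ⋃ s ∈ Set.Iic t, {ω | c < M s ω} := by ext; simp
    rw [this]
    refine MeasurableSet.biUnion (Set.to_countable _) fun s hs => ?_
    exact ℱ.mono hs _ (measurableSet_lt (@measurable_const _ _ _ (ℱ s) c)
      (hM s (le_trans hs ht)))
  -- The induction carries the mass that has already crossed `c`, plus the integral over the paths
  -- that have not. Paths crossing at time `t + 1` pay for themselves, since `M (t + 1) > c` there.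
  have key : ∀ t ≤ T, c * μ {ω | ∃ s ≤ t, c < M s ω} +
      ∫⁻ ω in {ω | ∃ s ≤ t, c < M s ω}ᶜ, M t ω ∂μ ≤ 1 := by
    intro t
    induction t with
    | zero =>
      intro ht
      have hCm : MeasurableSet {ω | ∃ s ≤ 0, c < M s ω} := ℱ.le 0 _ (hmeas 0 ht)
      refine le_trans ?_ ((lintegral_add_compl (M 0) hCm).trans_le h0)
      refine add_le_add_left ?_ _
      rw [← setLIntegral_const]
      refine setLIntegral_mono' hCm fun ω hω => ?_
      obtain ⟨s, hs, h⟩ := hω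
      rw [Nat.le_zero.1 hs] at h
      exact h.le
    | succ t ih =>
      intro ht
      have ih' := ih (by omega)
      set C := {ω | ∃ s ≤ t, c < M s ω} with hC
      set C' := {ω | ∃ s ≤ t + 1, c < M s ω} with hC'
      have hCm := hmeas t (by omega)
      have hCm' : MeasurableSet C' := ℱ.le _ _ (hmeas (t + 1) ht)
      have hsub : C ⊆ C' := fun ω ⟨s, hs, h⟩ => ⟨s, by omega, h⟩
      have h1 := hsuper t (by omega) Cᶜ hCm.compl
      rw [← lintegral_inter_add_sdiff _ Cᶜ hCm'] at h1
      have h2 : Cᶜ \ C' = C'ᶜ := by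
        ext ω
        simp only [Set.mem_sdiff, Set.mem_compl_iff]
        exact ⟨fun h => h.2, fun h => ⟨fun h' => h (hsub h'), h⟩⟩
      have h3 : c * μ (Cᶜ ∩ C') ≤ ∫⁻ ω in Cᶜ ∩ C', M (t + 1) ω ∂μ := by
        rw [← setLIntegral_const]
        refine setLIntegral_mono' ((ℱ.le _ _ hCm.compl).inter hCm') fun ω hω => ?_
        obtain ⟨hn, s, hs, h⟩ := hω
        rcases Nat.le_succ_iff.1 hs with h4 | h4
        · exact (hn ⟨s, h4, h⟩).elim
        · rw [h4] at h; exact h.le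
      have h4 : μ C' ≤ μ C + μ (Cᶜ ∩ C') := by
        refine (measure_mono fun ω hω => ?_).trans (measure_union_le _ _)
        by_cases h : ω ∈ C
        exacts [Or.inl h, Or.inr ⟨h, hω⟩]
      rw [h2] at h1
      calc c * μ C' + ∫⁻ ω in C'ᶜ, M (t + 1) ω ∂μ
          ≤ c * (μ C + μ (Cᶜ ∩ C')) + ∫⁻ ω in C'ᶜ, M (t + 1) ω ∂μ := by gcongr
        _ = c * μ C + (c * μ (Cᶜ ∩ C') + ∫⁻ ω in C'ᶜ, M (t + 1) ω ∂μ) := by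
            rw [mul_add, add_assoc]
        _ ≤ c * μ C + ∫⁻ ω in Cᶜ, M t ω ∂μ := by gcongr; exact (by gcongr : _ ≤ _).trans h1
        _ ≤ 1 := ih'
  exact le_self_add.trans (key T le_rfl)

theorem CondSubgaussian.div {R : ℝ} (hR : 0 < R)
    (h : CondSubgaussian m μ R z) : CondSubgaussian m μ 1 fun ω => z ω / R := by
  intro a
  have h1 := h (a / R)
  have h2 : ∀ ω, a * (z ω / R) = a / R * z ω := fun ω => by ring
  have h3 : (a / R) ^ 2 * R ^ 2 / 2 = a ^ 2 * 1 ^ 2 / 2 := by field_simp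
  simp_rw [h2, ← h3]
  exact h1

variable [IsProbabilityMeasure μ]

/-- The nonnegative function `e^z + e^(-z) - 2` has integral at most `0`, and it vanishes only at `z
= 0`. -/
theorem CondSubgaussian.ae_eq_zero (hm : m ≤ mΩ)
    (h : CondSubgaussian m μ 0 z) : ∀ᵐ ω ∂μ, z ω = 0 := by
  have hle : ∀ a : ℝ, ∫ ω, Real.exp (a * z ω) ∂μ ≤ 1 := fun a => by
    obtain ⟨hi, hc⟩ := h a
    rw [← integral_condExp hm]
    calc ∫ ω, (μ[fun ω => Real.exp (a * z ω) | m]) ω ∂μ ≤ ∫ _, (1 : ℝ) ∂μ := by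
          refine integral_mono_ae integrable_condExp (integrable_const _) ?_
          filter_upwards [hc] with ω hω
          simpa using hω
      _ = 1 := by simp
  have hi : Integrable (fun ω => Real.exp (1 * z ω) + Real.exp (-1 * z ω) - 2) μ :=
    ((h 1).1.add (h (-1)).1).sub (integrable_const _)
  have hnn : ∀ y : ℝ, 0 ≤ Real.exp (1 * y) + Real.exp (-1 * y) - 2 := fun y => by
    linarith [Real.add_one_le_exp (1 * y), Real.add_one_le_exp (-1 * y)]
  have h0 : ∫ ω, (Real.exp (1 * z ω) + Real.exp (-1 * z ω) - 2) ∂μ = 0 := by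
    refine le_antisymm ?_ (integral_nonneg fun ω => hnn _)
    rw [integral_sub (f := fun ω => Real.exp (1 * z ω) + Real.exp (-1 * z ω))
      ((h 1).1.add (h (-1)).1) (integrable_const _), integral_add (h 1).1 (h (-1)).1]
    have := hle 1
    have := hle (-1)
    simp only [integral_const, probReal_univ, smul_eq_mul]
    linarith
  rw [integral_eq_zero_iff_of_nonneg (fun ω => hnn _) hi] at h0
  filter_upwards [h0] with ω hω
  by_contra hne
  have h1 : Real.exp (1 * z ω) + Real.exp (-1 * z ω) - 2 = 0 := hω
  linarith [Real.add_one_lt_exp (x := 1 * z ω) (by simpa using hne),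
    Real.add_one_le_exp (-1 * z ω)]

theorem CondSubgaussian.setLIntegral_const (hm : m ≤ mΩ) (h : CondSubgaussian m μ 1 z) (a : ℝ)
    {s : Set Ω} (hs : MeasurableSet[m] s) :
    ∫⁻ ω in s, ENNReal.ofReal (Real.exp (a * z ω - a ^ 2 / 2)) ∂μ ≤ μ s := by
  obtain ⟨hi, hc⟩ := h a
  have h1 : ∫ ω in s, Real.exp (a * z ω) ∂μ ≤ Real.exp (a ^ 2 / 2) * μ.real s := by
    rw [← setIntegral_condExp hm hi hs]
    calc ∫ ω in s, (μ[fun ω => Real.exp (a * z ω) | m]) ω ∂μ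
        ≤ ∫ _ in s, Real.exp (a ^ 2 / 2) ∂μ := by
          refine setIntegral_mono_ae integrable_condExp.integrableOn
            (integrable_const _).integrableOn ?_
          filter_upwards [hc] with ω hω
          simpa using hω
      _ = _ := by simp [mul_comm]
  have h2 : ∀ ω, ENNReal.ofReal (Real.exp (a * z ω - a ^ 2 / 2)) =
      ENNReal.ofReal (Real.exp (-(a ^ 2 / 2))) * ENNReal.ofReal (Real.exp (a * z ω)) := fun ω => by
    rw [← ENNReal.ofReal_mul (by positivity), ← Real.exp_add]
    ring_nf
  simp_rw [h2]
  rw [lintegral_const_mul' _ _ ENNReal.ofReal_ne_top,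
    ← ofReal_integral_eq_lintegral_ofReal hi.integrableOn (by filter_upwards; intro; positivity),
    ← ENNReal.ofReal_mul (by positivity)]
  refine (ENNReal.ofReal_le_ofReal (mul_le_mul_of_nonneg_left h1 (by positivity))).trans_eq ?_
  rw [← mul_assoc, ← Real.exp_add, neg_add_cancel, Real.exp_zero, one_mul, ofReal_measureReal]

/-- Subgaussianity is assumed for deterministic exponents only, whereas the mixture needs an
`m`-measurable one. Here `s` is cut along the finitely many values of `f`; the general case follows
from simple approximations and Fatou's lemma. -/
theorem CondSubgaussian.setLIntegral_finite_range (hm : m ≤ mΩ) (h : CondSubgaussian m μ 1 z)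
    {f : Ω → ℝ} (hf : Measurable[m] f) (hfin : (Set.range f).Finite) {s : Set Ω}
    (hs : MeasurableSet[m] s) :
    ∫⁻ ω in s, ENNReal.ofReal (Real.exp (f ω * z ω - f ω ^ 2 / 2)) ∂μ ≤ μ s := by
  have hU : s = ⋃ c ∈ hfin.toFinset, s ∩ f ⁻¹' {c} := by
    ext ω
    simp
  have hmeas : ∀ c, MeasurableSet[m] (s ∩ f ⁻¹' {c}) := fun c =>
    hs.inter (hf (measurableSet_singleton c))
  have hdis : Set.PairwiseDisjoint (hfin.toFinset : Set ℝ) fun c => s ∩ f ⁻¹' {c} := by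
    intro c _ c' _ hcc
    refine Set.disjoint_left.2 fun ω h1 h2 => hcc ?_
    rw [← h1.2, ← h2.2]
  conv_lhs => rw [hU]
  conv_rhs => rw [hU]
  rw [lintegral_biUnion_finset hdis fun c _ => hm _ (hmeas c),
    measure_biUnion_finset hdis fun c _ => hm _ (hmeas c)]
  refine Finset.sum_le_sum fun c _ => ?_
  refine le_trans (le_of_eq ?_) (h.setLIntegral_const hm c (hmeas c))
  refine setLIntegral_congr_fun (hm _ (hmeas c)) fun ω hω => ?_
  have : f ω = c := hω.2
  simp [this]

theorem CondSubgaussian.setLIntegral_measurable (hm : m ≤ mΩ) (h : CondSubgaussian m μ 1 z)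
    (hz : Measurable z) {U : Ω → ℝ} (hU : Measurable[m] U) {s : Set Ω}
    (hs : MeasurableSet[m] s) :
    ∫⁻ ω in s, ENNReal.ofReal (Real.exp (U ω * z ω - U ω ^ 2 / 2)) ∂μ ≤ μ s := by
  have hU' : StronglyMeasurable[m] U := Measurable.stronglyMeasurable hU
  have hlim : ∀ ω, Filter.liminf (fun n => ENNReal.ofReal
      (Real.exp (hU'.approx n ω * z ω - hU'.approx n ω ^ 2 / 2))) Filter.atTop =
      ENNReal.ofReal (Real.exp (U ω * z ω - U ω ^ 2 / 2)) := fun ω => by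
    have hc : Continuous fun c : ℝ => ENNReal.ofReal (Real.exp (c * z ω - c ^ 2 / 2)) :=
      ENNReal.continuous_ofReal.comp (by fun_prop)
    exact ((hc.tendsto _).comp (hU'.tendsto_approx ω)).liminf_eq
  simp_rw [← hlim]
  have hmeas : ∀ n, Measurable fun ω => ENNReal.ofReal
      (Real.exp (hU'.approx n ω * z ω - hU'.approx n ω ^ 2 / 2)) := fun n => by
    have : Measurable (hU'.approx n) := (@SimpleFunc.measurable _ _ m _ (hU'.approx n)).mono hm le_rfl
    fun_prop
  refine (lintegral_liminf_le hmeas).trans ?_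
  refine Filter.liminf_le_of_le (by isBoundedDefault) fun b hb => ?_
  obtain ⟨n, hn⟩ := hb.exists
  exact hn.trans (h.setLIntegral_finite_range hm (@SimpleFunc.measurable _ _ m _ _)
    (@SimpleFunc.finite_range _ _ m _) hs)

theorem CondSubgaussian.lintegral_mul_le (hm : m ≤ mΩ) (h : CondSubgaussian m μ 1 z)
    (hz : Measurable z) {U : Ω → ℝ} (hU : Measurable[m] U) {Y : Ω → ENNReal}
    (hY : Measurable[m] Y) :
    ∫⁻ ω, Y ω * ENNReal.ofReal (Real.exp (U ω * z ω - U ω ^ 2 / 2)) ∂μ ≤ ∫⁻ ω, Y ω ∂μ := by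
  have hU' : Measurable U := hU.mono hm le_rfl
  have hg : Measurable fun ω => ENNReal.ofReal (Real.exp (U ω * z ω - U ω ^ 2 / 2)) := by
    fun_prop
  -- The set-wise bounds say that one measure on `m` dominates another; integrating `Y` against both
  -- adds the weight.
  have hle : (μ.withDensity fun ω =>
      ENNReal.ofReal (Real.exp (U ω * z ω - U ω ^ 2 / 2))).trim hm ≤ μ.trim hm := by
    refine @Measure.le_intro _ m _ _ fun s hs _ => ?_
    rw [trim_measurableSet_eq hm hs, trim_measurableSet_eq hm hs, withDensity_apply _ (hm _ hs)]
    exact h.setLIntegral_measurable hm hz hU hs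
  have h1 := @lintegral_mono' _ m _ _ hle Y Y le_rfl
  rw [lintegral_trim hm hY, lintegral_trim hm hY,
    lintegral_withDensity_eq_lintegral_mul _ hg (hY.mono hm le_rfl)] at h1
  simpa [mul_comm] using h1

/-- One step of the method of mixtures. -/
theorem CondSubgaussian.lintegral_mixture_le (hm : m ≤ mΩ) (h : CondSubgaussian m μ 1 z)
    (hz : Measurable z) {a w : Ω → ℝ} (ha : Measurable[m] a) (hw : Measurable[m] w)
    (hw0 : ∀ ω, 0 ≤ w ω) {Y : Ω → ENNReal} (hY : Measurable[m] Y) :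
    ∫⁻ ω, Y ω * ENNReal.ofReal ((√(1 + w ω))⁻¹ *
        Real.exp ((w ω * z ω ^ 2 + 2 * a ω * z ω - a ω ^ 2) / (2 * (1 + w ω)))) ∂μ ≤
      ∫⁻ ω, Y ω ∂μ := by
  have ha' : Measurable a := ha.mono hm le_rfl
  have hw' : Measurable w := hw.mono hm le_rfl
  have hY' : Measurable Y := hY.mono hm le_rfl
  have hg : Measurable fun p : Ω × ℝ => ENNReal.ofReal (Real.exp
      ((a p.1 + √(w p.1) * p.2) * z p.1 - (a p.1 + √(w p.1) * p.2) ^ 2 / 2)) := by fun_prop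
  have hpdf : Measurable fun u : ℝ => gaussianPDF 0 1 u := measurable_gaussianPDF 0 1
  -- The factor is an average over slopes `a + √w u` with `u` standard Gaussian. By Tonelli the
  -- average moves outside, and for fixed `u` the slope is `m`-measurable.
  calc _ = ∫⁻ ω, (∫⁻ u, Y ω * (ENNReal.ofReal (Real.exp
        ((a ω + √(w ω) * u) * z ω - (a ω + √(w ω) * u) ^ 2 / 2)) * gaussianPDF 0 1 u)) ∂μ := by
        refine lintegral_congr fun ω => ?_
        rw [lintegral_const_mul _ (by fun_prop), lintegral_exp_mul_gaussianPDF (hw0 ω)]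
    _ = ∫⁻ u, ∫⁻ ω, Y ω * (ENNReal.ofReal (Real.exp
        ((a ω + √(w ω) * u) * z ω - (a ω + √(w ω) * u) ^ 2 / 2)) * gaussianPDF 0 1 u) ∂μ := by
        refine lintegral_lintegral_swap (Measurable.aemeasurable ?_)
        exact (hY'.comp measurable_fst).mul (hg.mul (hpdf.comp measurable_snd))
    _ ≤ ∫⁻ u, (∫⁻ ω, Y ω ∂μ) * gaussianPDF 0 1 u := by
        refine lintegral_mono fun u => ?_
        simp_rw [← mul_assoc]
        rw [lintegral_mul_const _ (by fun_prop)]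
        refine mul_le_mul_left ?_ _
        exact h.lintegral_mul_le hm hz (U := fun ω => a ω + √(w ω) * u)
          (ha.add ((Real.continuous_sqrt.measurable.comp hw).mul_const u)) hY
    _ = _ := by
        rw [lintegral_const_mul _ hpdf, lintegral_gaussianPDF_eq_one _ one_ne_zero, mul_one]

end Mixture

/-! ### The self-normalized martingale bound. -/

section SelfNormalized

open Matrix

variable {d : ℕ}

/-- The regularized covariance matrix of the first `t` rows of the stream `x`. -/
def designMatrix (lam : ℝ) (x : ℕ → E d) (t : ℕ) : Matrix (Fin d) (Fin d) ℝ :=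
  lam • (1 : Matrix (Fin d) (Fin d) ℝ) + ∑ s ∈ Finset.range t, vecMulVec (x s).ofLp (x s).ofLp

/-- The sum of the first `t` rows of the stream `x`, weighted with the noise `z`. -/
def noiseSum (x : ℕ → E d) (z : ℕ → ℝ) (t : ℕ) : Fin d → ℝ :=
  ∑ s ∈ Finset.range t, z s • (x s).ofLp

theorem designMatrix_succ (lam : ℝ) (x : ℕ → E d) (t : ℕ) :
    designMatrix lam x (t + 1) =
      designMatrix lam x t + vecMulVec (x t).ofLp (x t).ofLp := by
  rw [designMatrix, designMatrix, Finset.sum_range_succ, add_assoc]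

theorem noiseSum_succ (x : ℕ → E d) (z : ℕ → ℝ) (t : ℕ) :
    noiseSum x z (t + 1) = noiseSum x z t + z t • (x t).ofLp :=
  Finset.sum_range_succ _ t

theorem posDef_smul_one {lam : ℝ} (hlam : 0 < lam) :
    (lam • (1 : Matrix (Fin d) (Fin d) ℝ)).PosDef :=
  PosDef.one.smul hlam

theorem posDef_designMatrix {lam : ℝ} (hlam : 0 < lam) (x : ℕ → E d) (t : ℕ) :
    (designMatrix lam x t).PosDef :=
  (posDef_smul_one hlam).add_posSemidef (posSemidef_sum _ fun _ _ => posSemidef_vecMulVec_self _)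

theorem quadForm_designMatrix (lam : ℝ) (x : ℕ → E d) (t : ℕ) (v : Fin d → ℝ) :
    v ⬝ᵥ designMatrix lam x t *ᵥ v =
      lam * (v ⬝ᵥ v) + ∑ s ∈ Finset.range t, ((x s).ofLp ⬝ᵥ v) ^ 2 := by
  rw [designMatrix, add_mulVec, dotProduct_add, smul_mulVec, one_mulVec, dotProduct_smul,
    smul_eq_mul, sum_mulVec, dotProduct_sum]
  simp_rw [quadForm_vecMulVec]

theorem det_designMatrix_zero (lam : ℝ) (x : ℕ → E d) : (designMatrix lam x 0).det = lam ^ d := by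
  simp [designMatrix]

theorem det_designMatrix_succ {lam : ℝ} (hlam : 0 < lam) (x : ℕ → E d) (t : ℕ) :
    (designMatrix lam x (t + 1)).det = (designMatrix lam x t).det *
      (1 + (x t).ofLp ⬝ᵥ (designMatrix lam x t)⁻¹ *ᵥ (x t).ofLp) := by
  rw [designMatrix_succ, det_add_vecMulVec (posDef_designMatrix hlam x t)]

/-- The Gaussian mixture supermartingale of the self-normalized bound. -/
def mixture (lam : ℝ) (x : ℕ → E d) (z : ℕ → ℝ) (t : ℕ) : ℝ :=
  (√((designMatrix lam x t).det / lam ^ d))⁻¹ *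
    Real.exp ((noiseSum x z t ⬝ᵥ (designMatrix lam x t)⁻¹ *ᵥ noiseSum x z t) / 2)

/-- The determinant lemma and Sherman–Morrison turn one step into the scalar factor of
`lintegral_mixture_le`, so no Gaussian integral over `ℝ^d` is needed. -/
theorem mixture_succ {lam : ℝ} (hlam : 0 < lam) (x : ℕ → E d) (z : ℕ → ℝ) (t : ℕ) :
    mixture lam x z (t + 1) = mixture lam x z t *
      ((√(1 + (x t).ofLp ⬝ᵥ (designMatrix lam x t)⁻¹ *ᵥ (x t).ofLp))⁻¹ *
        Real.exp ((((x t).ofLp ⬝ᵥ (designMatrix lam x t)⁻¹ *ᵥ (x t).ofLp) * z t ^ 2 +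
          2 * ((x t).ofLp ⬝ᵥ (designMatrix lam x t)⁻¹ *ᵥ noiseSum x z t) * z t -
          ((x t).ofLp ⬝ᵥ (designMatrix lam x t)⁻¹ *ᵥ noiseSum x z t) ^ 2) /
          (2 * (1 + (x t).ofLp ⬝ᵥ (designMatrix lam x t)⁻¹ *ᵥ (x t).ofLp)))) := by
  have hV := posDef_designMatrix hlam x t
  have hw := quadForm_nonneg hV.inv.posSemidef (x t).ofLp
  rw [mixture, mixture, det_designMatrix_succ hlam, noiseSum_succ, designMatrix_succ,
    quadForm_inv_add_vecMulVec hV, mul_div_right_comm,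
    Real.sqrt_mul (div_nonneg hV.det_pos.le (by positivity)), mul_inv, add_div, Real.exp_add]
  set w := (x t).ofLp ⬝ᵥ (designMatrix lam x t)⁻¹ *ᵥ (x t).ofLp
  set a := (x t).ofLp ⬝ᵥ (designMatrix lam x t)⁻¹ *ᵥ noiseSum x z t
  have : (z t ^ 2 * w + 2 * z t * a - a ^ 2) / (1 + w) / 2 =
      (w * z t ^ 2 + 2 * a * z t - a ^ 2) / (2 * (1 + w)) := by
    rw [div_div, mul_comm (1 + w) 2]
    ring_nf
  rw [this]
  ring

theorem mixture_nonneg (lam : ℝ) (x : ℕ → E d) (z : ℕ → ℝ) (t : ℕ) : 0 ≤ mixture lam x z t := by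
  unfold mixture
  positivity

theorem mixture_zero {lam : ℝ} (hlam : 0 < lam) (x : ℕ → E d) (z : ℕ → ℝ) :
    mixture lam x z 0 = 1 := by
  simp [mixture, det_designMatrix_zero, noiseSum, (pow_pos hlam d).ne']

variable {Ω : Type*}

theorem measurable_det {m : MeasurableSpace Ω} {n : ℕ} {A : Ω → Matrix (Fin n) (Fin n) ℝ}
    (hA : ∀ i j, Measurable fun ω => A ω i j) : Measurable fun ω => (A ω).det := by
  simp_rw [det_apply]
  refine Finset.measurable_sum _ fun σ _ => Measurable.const_smul ?_ _
  exact Finset.measurable_prod _ fun i _ => hA _ _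

theorem measurable_inv_apply {m : MeasurableSpace Ω} {n : ℕ} {A : Ω → Matrix (Fin n) (Fin n) ℝ}
    (hA : ∀ i j, Measurable fun ω => A ω i j) (i j : Fin n) :
    Measurable fun ω => (A ω)⁻¹ i j := by
  simp_rw [inv_def, Ring.inverse_eq_inv', Matrix.smul_apply, smul_eq_mul, adjugate_apply]
  refine (measurable_det hA).inv.mul (measurable_det fun k l => ?_)
  by_cases h : k = j
  · subst h
    simp
  · simpa [updateRow_ne h] using hA k l

theorem measurable_bilinForm {m : MeasurableSpace Ω} {n : ℕ} {A : Ω → Matrix (Fin n) (Fin n) ℝ}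
    (hA : ∀ i j, Measurable fun ω => A ω i j) {u v : Ω → Fin n → ℝ}
    (hu : ∀ i, Measurable fun ω => u ω i) (hv : ∀ i, Measurable fun ω => v ω i) :
    Measurable fun ω => u ω ⬝ᵥ A ω *ᵥ v ω := by
  simp only [dotProduct, mulVec]
  exact Finset.measurable_sum _ fun i _ => (hu i).mul
    (Finset.measurable_sum _ fun j _ => (hA i j).mul (hv j))

theorem measurable_designMatrix {m : MeasurableSpace Ω} (lam : ℝ) {x : ℕ → Ω → E d} {t : ℕ}
    (hx : ∀ s < t, Measurable (x s)) (i j : Fin d) :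
    Measurable fun ω => designMatrix lam (fun s => x s ω) t i j := by
  simp only [designMatrix, Matrix.add_apply, Matrix.smul_apply, Matrix.sum_apply, vecMulVec_apply]
  refine measurable_const.add (Finset.measurable_sum _ fun s hs => ?_)
  have := hx s (Finset.mem_range.1 hs)
  fun_prop

theorem measurable_noiseSum {m : MeasurableSpace Ω} {x : ℕ → Ω → E d} {z : ℕ → Ω → ℝ} {t : ℕ}
    (hx : ∀ s < t, Measurable (x s)) (hz : ∀ s < t, Measurable (z s)) (i : Fin d) :
    Measurable fun ω => noiseSum (fun s => x s ω) (fun s => z s ω) t i := by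
  simp only [noiseSum, Finset.sum_apply, Pi.smul_apply, smul_eq_mul]
  refine Finset.measurable_sum _ fun s hs => ?_
  have := hx s (Finset.mem_range.1 hs)
  have := hz s (Finset.mem_range.1 hs)
  fun_prop

variable {mΩ : MeasurableSpace Ω} {μ : Measure Ω} [IsProbabilityMeasure μ]

theorem measure_mixture_le (ℱ : Filtration ℕ mΩ) {lam : ℝ} (hlam : 0 < lam) {T : ℕ}
    {x : ℕ → Ω → E d} {z : ℕ → Ω → ℝ} (hx : ∀ t < T, Measurable[ℱ t] (x t))
    (hz : ∀ t < T, Measurable[ℱ (t + 1)] (z t)) (hsub : ∀ t < T, CondSubgaussian (ℱ t) μ 1 (z t))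
    (c : ENNReal) :
    c * μ {ω | ∃ t ≤ T, c < ENNReal.ofReal
      (mixture lam (fun s => x s ω) (fun s => z s ω) t)} ≤ 1 := by
  have hx' : ∀ t ≤ T, ∀ s < t, Measurable[ℱ t] (x s) := fun t ht s hs =>
    (hx s (by omega)).mono (ℱ.mono hs.le) le_rfl
  have hz' : ∀ t ≤ T, ∀ s < t, Measurable[ℱ t] (z s) := fun t ht s hs =>
    (hz s (by omega)).mono (ℱ.mono hs) le_rfl
  have hVm : ∀ t ≤ T, ∀ i j, Measurable[ℱ t] fun ω => designMatrix lam (fun s => x s ω) t i j :=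
    fun t ht => measurable_designMatrix lam (hx' t ht)
  have hSm : ∀ t ≤ T, ∀ i, Measurable[ℱ t] fun ω =>
      noiseSum (fun s => x s ω) (fun s => z s ω) t i :=
    fun t ht => measurable_noiseSum (hx' t ht) (hz' t ht)
  have hM : ∀ t ≤ T, Measurable[ℱ t] fun ω =>
      ENNReal.ofReal (mixture lam (fun s => x s ω) (fun s => z s ω) t) := fun t ht => by
    refine ENNReal.measurable_ofReal.comp (Measurable.mul (Measurable.inv ?_) ?_)
    · exact Real.continuous_sqrt.measurable.comp ((measurable_det (hVm t ht)).div_const _)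
    · exact Real.measurable_exp.comp ((measurable_bilinForm
        (measurable_inv_apply (hVm t ht)) (hSm t ht) (hSm t ht)).div_const _)
  refine mul_measure_exists_lt_le ℱ hM (fun t ht s hs => ?_) (by simp [mixture_zero hlam]) c
  have hxc : ∀ i, Measurable[ℱ t] fun ω => (x t ω).ofLp i := fun i => by
    have := hx t ht
    fun_prop
  -- The indicator of the past event `s` is absorbed into the weight `Y`.
  have hstep := (hsub t ht).lintegral_mixture_le (ℱ.le t) ((hz t ht).mono (ℱ.le _) le_rfl)
    (measurable_bilinForm (measurable_inv_apply (hVm t ht.le)) hxc (hSm t ht.le))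
    (measurable_bilinForm (measurable_inv_apply (hVm t ht.le)) hxc hxc)
    (fun ω => quadForm_nonneg (posDef_designMatrix hlam _ t).inv.posSemidef _)
    ((hM t ht.le).indicator hs)
  rw [← lintegral_indicator (ℱ.le t _ hs), ← lintegral_indicator (ℱ.le t _ hs)]
  refine le_trans (le_of_eq (lintegral_congr fun ω => ?_)) hstep
  by_cases hω : ω ∈ s
  · simp only [Set.indicator_of_mem hω]
    rw [mixture_succ hlam, ENNReal.ofReal_mul (mixture_nonneg _ _ _ _)]
  · simp [Set.indicator_of_notMem hω]

/-- The self-normalized bound for vector-valued martingales. -/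
theorem measure_selfNormalized_le (ℱ : Filtration ℕ mΩ) {lam R : ℝ} (hlam : 0 < lam) (hR : 0 ≤ R)
    {T : ℕ} (hT : 1 ≤ T) {x : ℕ → Ω → E d} {z : ℕ → Ω → ℝ} (hx : ∀ t < T, Measurable[ℱ t] (x t))
    (hz : ∀ t < T, Measurable[ℱ (t + 1)] (z t))
    (hsub : ∀ t < T, CondSubgaussian (ℱ t) μ R (z t)) :
    μ {ω | ∃ t ≤ T, R ^ 2 * (2 * Real.log T +
        Real.log ((designMatrix lam (fun s => x s ω) t).det / lam ^ d)) <
        noiseSum (fun s => x s ω) (fun s => z s ω) t ⬝ᵥ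
          (designMatrix lam (fun s => x s ω) t)⁻¹ *ᵥ
          noiseSum (fun s => x s ω) (fun s => z s ω) t} ≤ ENNReal.ofReal (1 / T) := by
  have hT' : (0 : ℝ) < T := by exact_mod_cast hT
  -- For `R = 0` rescaling by `R` is impossible, but the noise vanishes almost surely.
  rcases hR.eq_or_lt with rfl | hR
  · have h0 : ∀ᵐ ω ∂μ, ∀ t < T, z t ω = 0 := by
      rw [ae_all_iff]
      intro t
      by_cases ht : t < T
      · filter_upwards [(hsub t ht).ae_eq_zero (ℱ.le t)] with ω hω _ using hω
      · exact Filter.Eventually.of_forall fun ω h => (ht h).elim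
    refine le_trans (le_of_eq ?_) zero_le
    rw [measure_eq_zero_iff_ae_notMem]
    filter_upwards [h0] with ω hω
    rintro ⟨t, ht, hlt⟩
    have : noiseSum (fun s => x s ω) (fun s => z s ω) t = 0 :=
      Finset.sum_eq_zero fun s hs => by
        simp [hω s (lt_of_lt_of_le (Finset.mem_range.1 hs) ht)]
    simp [this] at hlt
  -- The threshold `T` is `1 / δ`: the logarithm of `mixture > T` is exactly the violated bound for
  -- the noise divided by `R`.
  have key := measure_mixture_le ℱ hlam (z := fun t ω => z t ω / R) hx
    (fun t ht => (hz t ht).div_const R) (fun t ht => (hsub t ht).div hR) (ENNReal.ofReal T)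
  have hpos : ENNReal.ofReal T ≠ 0 := by simpa using by omega
  rw [one_div, ENNReal.ofReal_inv_of_pos hT', ENNReal.le_inv_iff_mul_le, mul_comm]
  refine le_trans (mul_le_mul_right (measure_mono fun ω hω => ?_) _) key
  obtain ⟨t, ht, hlt⟩ := hω
  refine ⟨t, ht, ?_⟩
  set V := designMatrix lam (fun s => x s ω) t
  have hS : noiseSum (fun s => x s ω) (fun s => z s ω / R) t =
      R⁻¹ • noiseSum (fun s => x s ω) (fun s => z s ω) t := by
    rw [noiseSum, noiseSum, Finset.smul_sum]
    exact Finset.sum_congr rfl fun s _ => by rw [smul_smul, div_eq_inv_mul]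
  set D := V.det / lam ^ d with hD
  have hDpos : 0 < D := div_pos (posDef_designMatrix hlam _ t).det_pos (pow_pos hlam d)
  rw [mixture, hS, quadForm_smul, ENNReal.ofReal_lt_ofReal_iff_of_nonneg hT'.le]
  set q := noiseSum (fun s => x s ω) (fun s => z s ω) t ⬝ᵥ
    V⁻¹ *ᵥ noiseSum (fun s => x s ω) (fun s => z s ω) t
  have h1 : 2 * Real.log T + Real.log D < R⁻¹ ^ 2 * q := by
    rw [inv_pow, inv_mul_eq_div, lt_div_iff₀ (by positivity)]
    linarith
  rw [← Real.log_lt_log_iff hT' (by positivity), Real.log_mul (by positivity) (by positivity),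
    Real.log_exp, Real.log_inv, Real.log_sqrt hDpos.le]
  linarith

end SelfNormalized

/-! ### The confidence ellipsoid of the sketched estimate. -/

section Confidence

open Matrix

variable {d l₀ : ℕ}

theorem quadForm_covariance (lam : ℝ) (st : State d l₀) (v : Fin d → ℝ) :
    v ⬝ᵥ st.covariance lam *ᵥ v = v ⬝ᵥ st.gram *ᵥ v + lam * (v ⬝ᵥ v) := by
  rw [State.covariance, add_mulVec, dotProduct_add, smul_mulVec, one_mulVec, dotProduct_smul,
    smul_eq_mul]

/-- After applying `Â⁻¹`, the error of the estimate splits into noise, sketching bias and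
regularization bias. -/
theorem sum_reward_smul_eq (lam : ℝ) (x : ℕ → E d) (t : ℕ) (st : State d l₀) (θ : E d) (z : ℕ → ℝ) :
    (∑ s ∈ Finset.range t, (inner ℝ (x s) θ + z s) • x s).ofLp =
      st.covariance lam *ᵥ θ.ofLp + (noiseSum x z t +
        ((∑ s ∈ Finset.range t, vecMulVec (x s).ofLp (x s).ofLp - st.gram) *ᵥ θ.ofLp +
          (-lam) • θ.ofLp)) := by
  have h1 : (∑ s ∈ Finset.range t, (inner ℝ (x s) θ + z s) • x s).ofLp =
      (∑ s ∈ Finset.range t, vecMulVec (x s).ofLp (x s).ofLp) *ᵥ θ.ofLp + noiseSum x z t := by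
    rw [WithLp.ofLp_sum, sum_mulVec, noiseSum, ← Finset.sum_add_distrib]
    refine Finset.sum_congr rfl fun s _ => ?_
    rw [WithLp.ofLp_smul, add_smul, vecMulVec_mulVec, inner_eq_dotProduct]
    simp
  rw [h1, sub_mulVec, State.covariance, add_mulVec, smul_mulVec, one_mulVec, neg_smul]
  abel

namespace GramInv

variable {ε lam L : ℝ} {x : ℕ → E d} {t : ℕ} {st : State d l₀}

theorem posDef_covariance (h : GramInv ε x t st) (hlam : 0 < lam) :
    (st.covariance lam).PosDef :=
  PosDef.posSemidef_add h.posSemidef (posDef_smul_one hlam)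

theorem one_le (h : GramInv ε x t st) (hlam : 0 < lam) : 1 ≤ 1 + st.totalShrink / lam := by
  linarith [div_nonneg h.shrink_nonneg hlam.le]

/-- The lost covariance is at most `σ̄ I = (σ̄ / λ) (λ I) ≤ (σ̄ / λ) Â`. -/
theorem designMatrix_le (h : GramInv ε x t st) (hlam : 0 < lam) (v : Fin d → ℝ) :
    v ⬝ᵥ designMatrix lam x t *ᵥ v ≤
      (1 + st.totalShrink / lam) * (v ⬝ᵥ st.covariance lam *ᵥ v) := by
  rw [quadForm_designMatrix, quadForm_covariance]
  have h1 := h.le_gram v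
  have h2 : 0 ≤ st.totalShrink / lam * (v ⬝ᵥ st.gram *ᵥ v) :=
    mul_nonneg (div_nonneg h.shrink_nonneg hlam.le) (quadForm_nonneg h.posSemidef v)
  have h3 : st.totalShrink / lam * (lam * (v ⬝ᵥ v)) = st.totalShrink * (v ⬝ᵥ v) := by
    field_simp
  linarith

theorem quadForm_inv_covariance_le (h : GramInv ε x t st) (hlam : 0 < lam) (v : Fin d → ℝ) :
    v ⬝ᵥ (st.covariance lam)⁻¹ *ᵥ v ≤
      (1 + st.totalShrink / lam) * (v ⬝ᵥ (designMatrix lam x t)⁻¹ *ᵥ v) :=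
  quadForm_inv_le_of_le (posDef_designMatrix hlam x t) (h.posDef_covariance hlam)
    (by linarith [h.one_le hlam]) (h.designMatrix_le hlam) v

theorem quadForm_inv_covariance_le_div (h : GramInv ε x t st) (hlam : 0 < lam) (v : Fin d → ℝ) :
    v ⬝ᵥ (st.covariance lam)⁻¹ *ᵥ v ≤ (v ⬝ᵥ v) / lam :=
  quadForm_inv_le_of_smul_le (h.posDef_covariance hlam) hlam (fun u => by
    rw [quadForm_covariance]
    linarith [quadForm_nonneg h.posSemidef u]) v

theorem trace_gram_le (h : GramInv ε x t st) (hL : ∀ s < t, ‖x s‖ ≤ L) :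
    st.gram.trace ≤ t * L ^ 2 := by
  have h1 : ∀ i, st.gram i i ≤ ∑ s ∈ Finset.range t, (x s).ofLp i ^ 2 := fun i => by
    simpa using h.gram_le (Pi.single i 1)
  calc st.gram.trace ≤ ∑ i, ∑ s ∈ Finset.range t, (x s).ofLp i ^ 2 :=
        Finset.sum_le_sum fun i _ => h1 i
    _ = ∑ s ∈ Finset.range t, ‖x s‖ ^ 2 := by
        rw [Finset.sum_comm]
        simp_rw [EuclideanSpace.real_norm_sq_eq]
    _ ≤ ∑ _s ∈ Finset.range t, L ^ 2 := Finset.sum_le_sum fun s hs =>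
        pow_le_pow_left₀ (norm_nonneg _) (hL s (Finset.mem_range.1 hs)) 2
    _ = _ := by simp

theorem log_det_one_add_gram_le (h : GramInv ε x t st) (hlam : 0 < lam)
    (hL : ∀ s < t, ‖x s‖ ≤ L) :
    Real.log (1 + lam⁻¹ • st.gram).det ≤
      st.rankBound * Real.log (1 + t * L ^ 2 / (st.rankBound * lam)) := by
  have htr := h.trace_gram_le hL
  have htr0 : 0 ≤ lam⁻¹ * st.gram.trace :=
    mul_nonneg (inv_nonneg.2 hlam.le) h.posSemidef.trace_nonneg
  have hmono : ∀ n : ℕ, n ≤ st.rankBound →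
      (n : ℝ) * Real.log (1 + lam⁻¹ * st.gram.trace / n) ≤
        st.rankBound * Real.log (1 + t * L ^ 2 / (st.rankBound * lam)) := fun n hn => by
    refine (mul_log_one_add_div_le htr0 (Nat.cast_nonneg n) (Nat.cast_le.2 hn)).trans ?_
    have h1 : lam⁻¹ * st.gram.trace / st.rankBound ≤ t * L ^ 2 / (st.rankBound * lam) := by
      rw [inv_mul_eq_div, div_div, mul_comm lam]
      gcongr
    have h2 : 0 ≤ lam⁻¹ * st.gram.trace / st.rankBound := by positivity
    gcongr
  by_cases hsat : st.Saturated
  · have hd : d ≤ st.rankBound := by rw [State.rankBound, if_pos hsat]; exact le_max_right _ _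
    have := log_det_one_add_le (h.posSemidef.smul (inv_nonneg.2 hlam.le))
    rw [trace_smul, smul_eq_mul, Fintype.card_fin] at this
    exact this.trans (hmono d hd)
  · obtain ⟨hg, -⟩ := h.gram_eq hsat
    have hps : (lam⁻¹ • (st.stacked * st.stackedᵀ)).PosSemidef :=
      (posSemidef_mul_transpose_self _).smul (inv_nonneg.2 hlam.le)
    have h1 := log_det_one_add_le hps
    -- By `det (1 + AB) = det (1 + BA)` the dimension `d` is replaced by the number of stacked rows,
    -- `(2 ^ (B + 1) - 1) * l₀ ≤ 2 l_B`.
    have h2 : (1 + lam⁻¹ • st.gram).det = (1 + lam⁻¹ • (st.stacked * st.stackedᵀ)).det := by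
      rw [hg, ← Matrix.smul_mul, det_one_add_mul_comm, Matrix.mul_smul]
    have h3 : (lam⁻¹ • (st.stacked * st.stackedᵀ)).trace = lam⁻¹ * st.gram.trace := by
      rw [trace_smul, trace_mul_comm, ← hg, smul_eq_mul]
    rw [h2]
    rw [h3] at h1
    refine h1.trans (hmono _ ?_)
    rw [State.rankBound, if_neg hsat, Fintype.card_sigma, State.length]
    simp only [Fintype.card_fin]
    rw [← Finset.sum_mul, ← mul_assoc, ← pow_succ', ← Finset.sum_range (fun i => 2 ^ i),
      Nat.geomSum_eq le_rfl]
    exact Nat.mul_le_mul_right _ (by simp)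

theorem log_det_designMatrix_le (h : GramInv ε x t st) (hlam : 0 < lam)
    (hL : ∀ s < t, ‖x s‖ ≤ L) :
    Real.log ((designMatrix lam x t).det / lam ^ d) ≤
      d * Real.log (1 + st.totalShrink / lam) +
        st.rankBound * Real.log (1 + t * L ^ 2 / (st.rankBound * lam)) := by
  have hV := posDef_designMatrix hlam x t
  have hc := h.one_le hlam
  have hA := h.posDef_covariance hlam
  have h1 : (designMatrix lam x t).det ≤ ((1 + st.totalShrink / lam) • st.covariance lam).det :=
    det_le_det_of_le hV (hA.smul (by linarith : 0 < 1 + st.totalShrink / lam)).isHermitian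
      fun u => by
        rw [smul_mulVec, dotProduct_smul, smul_eq_mul]
        exact h.designMatrix_le hlam u
  have h2 : st.covariance lam = lam • (1 + lam⁻¹ • st.gram) := by
    rw [smul_add, smul_smul, mul_inv_cancel₀ hlam.ne', one_smul, add_comm, State.covariance]
  have hG : 0 < (1 + lam⁻¹ • st.gram).det :=
    (PosDef.one.add_posSemidef (h.posSemidef.smul (inv_nonneg.2 hlam.le))).det_pos
  rw [h2, det_smul, det_smul, Fintype.card_fin] at h1
  have h3 : (designMatrix lam x t).det / lam ^ d ≤
      (1 + st.totalShrink / lam) ^ d * (1 + lam⁻¹ • st.gram).det := by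
    rw [div_le_iff₀ (by positivity)]
    linarith
  refine (Real.log_le_log (div_pos hV.det_pos (by positivity)) h3).trans ?_
  rw [Real.log_mul (by positivity) hG.ne', Real.log_pow]
  have := h.log_det_one_add_gram_le hlam hL
  linarith

/-- The lost covariance `P` satisfies `0 ≤ P ≤ σ̄ I`, hence `‖P θ‖ ≤ σ̄ ‖θ‖`; the `Â⁻¹` norm costs a
further `1 / √λ`. -/
theorem weighted_error_le (h : GramInv ε x t st) (hlam : 0 < lam) (θ : E d) :
    √(((∑ s ∈ Finset.range t, vecMulVec (x s).ofLp (x s).ofLp - st.gram) *ᵥ θ.ofLp +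
        (-lam) • θ.ofLp) ⬝ᵥ (st.covariance lam)⁻¹ *ᵥ
        ((∑ s ∈ Finset.range t, vecMulVec (x s).ofLp (x s).ofLp - st.gram) *ᵥ θ.ofLp +
        (-lam) • θ.ofLp)) ≤ ‖θ‖ * ((lam + st.totalShrink) / √lam) := by
  have hA := h.posDef_covariance hlam
  set P := ∑ s ∈ Finset.range t, vecMulVec (x s).ofLp (x s).ofLp - st.gram with hP
  have hq : ∀ v, v ⬝ᵥ P *ᵥ v =
      ∑ s ∈ Finset.range t, ((x s).ofLp ⬝ᵥ v) ^ 2 - v ⬝ᵥ st.gram *ᵥ v := fun v => by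
    rw [hP, sub_mulVec, dotProduct_sub, sum_mulVec, dotProduct_sum]
    simp_rw [quadForm_vecMulVec]
  have hPs : P.PosSemidef := by
    refine posSemidef_of_quadForm_nonneg (IsHermitian.sub (posSemidef_sum _ fun _ _ =>
      posSemidef_vecMulVec_self _).isHermitian h.posSemidef.isHermitian) fun v => ?_
    rw [hq]
    linarith [h.gram_le v]
  have hPle : ∀ v, v ⬝ᵥ P *ᵥ v ≤ st.totalShrink * (v ⬝ᵥ v) := fun v => by
    rw [hq]
    linarith [h.le_gram v]
  set u := P *ᵥ θ.ofLp with hu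
  have hsh := h.shrink_nonneg
  have hu2 : u ⬝ᵥ u ≤ (st.totalShrink * ‖θ‖) ^ 2 := by
    rcases (dotProduct_self_nonneg u).eq_or_lt with h0 | h0
    · rw [← h0]; positivity
    -- With `u = P θ`, Cauchy–Schwarz for the form `P` gives `‖u‖⁴ ≤ (uᵀPu)(θᵀPθ) ≤ σ̄² ‖u‖² ‖θ‖²`,
    -- and `‖u‖²` cancels.
    refine le_of_mul_le_mul_left ?_ h0
    have h1 := sq_dotProduct_mulVec_le hPs u θ.ofLp
    rw [← hu] at h1
    have h2 := hPle θ.ofLp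
    rw [dotProduct_ofLp_self, ← hu] at h2
    have h3 : 0 ≤ θ.ofLp ⬝ᵥ u := quadForm_nonneg hPs θ.ofLp
    have h4 := mul_le_mul (hPle u) h2 h3 (mul_nonneg hsh h0.le)
    nlinarith
  have h1 : √(u ⬝ᵥ (st.covariance lam)⁻¹ *ᵥ u) ≤ st.totalShrink * ‖θ‖ / √lam := by
    refine (Real.sqrt_le_sqrt (h.quadForm_inv_covariance_le_div hlam u)).trans ?_
    rw [Real.sqrt_div (dotProduct_self_nonneg u)]
    gcongr
    exact Real.sqrt_le_left (by positivity) |>.2 hu2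
  have h2 : √(((-lam) • θ.ofLp) ⬝ᵥ (st.covariance lam)⁻¹ *ᵥ ((-lam) • θ.ofLp)) ≤
      lam * ‖θ‖ / √lam := by
    refine (Real.sqrt_le_sqrt (h.quadForm_inv_covariance_le_div hlam _)).trans ?_
    rw [Real.sqrt_div (dotProduct_self_nonneg _)]
    gcongr
    rw [Real.sqrt_le_left (by positivity), smul_dotProduct, dotProduct_smul, dotProduct_ofLp_self]
    simp only [smul_eq_mul]
    exact le_of_eq (by ring)
  calc _ ≤ _ := sqrt_quadForm_add_le hA.inv.posSemidef _ _
    _ ≤ _ := add_le_add h1 h2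
    _ = _ := by ring

/-- The confidence ellipsoid contains the unknown parameter whenever the self-normalized bound
holds. -/
theorem abs_inner_estimate_sub_le (h : GramInv ε x t st) (hlam : 0 < lam)
    (hL : ∀ s < t, ‖x s‖ ≤ L) {H R δ : ℝ} (hR : 0 ≤ R) {θ : E d} (hθ : ‖θ‖ ≤ H) {z : ℕ → ℝ}
    (hz : noiseSum x z t ⬝ᵥ (designMatrix lam x t)⁻¹ *ᵥ noiseSum x z t ≤
      R ^ 2 * (2 * Real.log (1 / δ) + Real.log ((designMatrix lam x t).det / lam ^ d)))
    (y : E d) :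
    |inner ℝ y (estimate lam st t x (fun s => inner ℝ (x s) θ + z s)) - inner ℝ y θ| ≤
      st.radius lam L H R δ t * weightedNorm (st.covariance lam)⁻¹ y := by
  have hA := h.posDef_covariance hlam
  have hc := h.one_le hlam
  set e := (∑ s ∈ Finset.range t, vecMulVec (x s).ofLp (x s).ofLp - st.gram) *ᵥ θ.ofLp +
    (-lam) • θ.ofLp with he
  have h1 : inner ℝ y (estimate lam st t x (fun s => inner ℝ (x s) θ + z s)) - inner ℝ y θ =
      y.ofLp ⬝ᵥ (st.covariance lam)⁻¹ *ᵥ (noiseSum x z t + e) := by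
    rw [inner_eq_dotProduct, inner_eq_dotProduct, estimate, sum_reward_smul_eq lam x t st, ← he]
    simp only
    rw [mulVec_add, inv_mulVec_mulVec hA, dotProduct_add]
    ring
  rw [h1]
  refine (abs_dotProduct_mulVec_le hA.inv.posSemidef _ _).trans ?_
  rw [mul_comm, weightedNorm]
  refine mul_le_mul_of_nonneg_right ?_ (Real.sqrt_nonneg _)
  refine (sqrt_quadForm_add_le hA.inv.posSemidef _ _).trans ?_
  rw [State.radius]
  refine add_le_add ?_ ((h.weighted_error_le hlam θ).trans ?_)
  · have h2 := h.quadForm_inv_covariance_le hlam (noiseSum x z t)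
    have h3 := h.log_det_designMatrix_le hlam hL
    have h4 : noiseSum x z t ⬝ᵥ (st.covariance lam)⁻¹ *ᵥ noiseSum x z t ≤
        R ^ 2 * ((1 + st.totalShrink / lam) * (2 * Real.log (1 / δ) +
          d * Real.log (1 + st.totalShrink / lam) +
          st.rankBound * Real.log (1 + t * L ^ 2 / (st.rankBound * lam)))) := by
      refine h2.trans ?_
      calc _ ≤ (1 + st.totalShrink / lam) * (R ^ 2 * (2 * Real.log (1 / δ) +
            (d * Real.log (1 + st.totalShrink / lam) +
            st.rankBound * Real.log (1 + t * L ^ 2 / (st.rankBound * lam))))) := by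
            gcongr
            exact hz.trans (by gcongr)
        _ = _ := by ring
    refine (Real.sqrt_le_sqrt h4).trans_eq ?_
    rw [Real.sqrt_mul (sq_nonneg R), Real.sqrt_sq hR, Real.sqrt_mul (by positivity), mul_assoc]
  · have := h.shrink_nonneg
    gcongr

end GramInv

/-- The elliptical potential lemma. -/
theorem sum_min_le_log_det {lam : ℝ} (hlam : 0 < lam) (x : ℕ → E d) (T : ℕ) :
    ∑ t ∈ Finset.range T, min 1 ((x t).ofLp ⬝ᵥ (designMatrix lam x t)⁻¹ *ᵥ (x t).ofLp) ≤
      2 * Real.log ((designMatrix lam x T).det / lam ^ d) := by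
  induction T with
  | zero => simp [det_designMatrix_zero, (pow_pos hlam d).ne']
  | succ T ih =>
    have hV := posDef_designMatrix hlam x T
    have hw := quadForm_nonneg hV.inv.posSemidef (x T).ofLp
    rw [Finset.sum_range_succ, det_designMatrix_succ hlam, mul_div_right_comm,
      Real.log_mul (div_pos hV.det_pos (by positivity)).ne' (by positivity)]
    set w := (x T).ofLp ⬝ᵥ (designMatrix lam x T)⁻¹ *ᵥ (x T).ofLp
    have hu0 : 0 ≤ min 1 w := le_min zero_le_one hw
    -- The truncation at `1` keeps `v / (1 + v) ≥ v / 2` for `v = min 1 w`.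
    have h1 : min 1 w / 2 ≤ Real.log (1 + w) := by
      calc min 1 w / 2 ≤ 1 - (1 + min 1 w)⁻¹ := by
            have : 1 - (1 + min 1 w)⁻¹ = min 1 w / (1 + min 1 w) := by field_simp; ring
            rw [this]
            gcongr
            linarith [min_le_left 1 w]
        _ ≤ Real.log (1 + min 1 w) := Real.one_sub_inv_le_log_of_pos (by positivity)
        _ ≤ Real.log (1 + w) := Real.log_le_log (by positivity) (by linarith [min_le_right 1 w])
    linarith

end Confidence

/-! ### From confidence radii to the regret. -/

section Regret

open Matrix

variable {d l₀ : ℕ} {ε lam L H R δ : ℝ} {T : ℕ} {𝒳 : ℕ → Set (E d)} {x : ℕ → E d} {r : ℕ → ℝ}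
  {st : ℕ → State d l₀}

theorem IsRun.gramInv (h : IsRun ε lam L H R δ T 𝒳 x r st) (hε : 0 ≤ ε) (hl₀ : 1 ≤ l₀) {t : ℕ}
    (ht : t ≤ T) : GramInv ε x t (st t) := by
  induction t with
  | zero => rw [h.init]; exact gramInv_init hε x
  | succ t ih => exact (ih (by omega)).step hε hl₀ (h.step t ht)

theorem Saturated.congr {st st' : State d l₀} (h : st'.B = st.B) (hs : st.Saturated) :
    st'.Saturated := by
  unfold State.Saturated at *
  rwa [h]

theorem IsRun.B_le (h : IsRun ε lam L H R δ T 𝒳 x r st) {s t : ℕ} (hst : s ≤ t) (ht : t ≤ T) :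
    (st s).B ≤ (st t).B ∧ ((st s).Saturated → (st t).B = (st s).B) := by
  induction t, hst using Nat.le_induction with
  | base => exact ⟨le_rfl, fun _ => rfl⟩
  | succ t _ ih =>
    obtain ⟨h1, h2⟩ := ih (by omega)
    obtain ⟨h3, h4⟩ := Step.B_le (h.step t ht)
    exact ⟨h1.trans h3, fun hs => (h4 (Saturated.congr (h2 hs) hs)).trans (h2 hs)⟩

theorem two_mul_length_le_rankBound (st : State d l₀) : 2 * st.length ≤ st.rankBound := by
  unfold State.rankBound
  split_ifs
  exacts [le_max_left _ _, le_rfl]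

theorem rankBound_le_of_saturated (hl₀ : 1 ≤ l₀) {st : State d l₀} (h : st.Saturated) :
    st.rankBound ≤ 2 * (2 * st.length) := by
  have := le_four_mul_length_of_saturated hl₀ h
  rw [State.rankBound, if_pos h, max_le_iff]
  omega

/-- Before saturation the rank bound is `2 l_B` with `B` nondecreasing, so monotonicity in the
dimension suffices. After saturation `B` is frozen and the rank bound is at most twice `2 l_B`,
whence the factor `2`. -/
theorem IsRun.rank_log_le (h : IsRun ε lam L H R δ T 𝒳 x r st) (hlam : 0 < lam)
    (hl₀ : 1 ≤ l₀) {t : ℕ} (ht : t ≤ T) :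
    (st t).rankBound * Real.log (1 + t * L ^ 2 / ((st t).rankBound * lam)) ≤
      2 * (2 * ((st T).length : ℝ) *
        Real.log (1 + T * L ^ 2 / (2 * ((st T).length : ℝ) * lam))) := by
  obtain ⟨hB, hsat⟩ := h.B_le ht le_rfl
  have hlpos : ∀ s, 1 ≤ (st s).length := fun s => Nat.mul_pos (by positivity) hl₀
  have hk1 := two_mul_length_le_rankBound (st t)
  have hkpos : (0 : ℝ) < (st t).rankBound := by
    have := hlpos t
    exact_mod_cast (by omega : 0 < (st t).rankBound)
  have hlT : (0 : ℝ) < (st T).length := by exact_mod_cast hlpos T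
  have htT : (t : ℝ) ≤ T := by exact_mod_cast ht
  have hlog0 : 0 ≤ Real.log (1 + T * L ^ 2 / (2 * ((st T).length : ℝ) * lam)) :=
    Real.log_nonneg (by
      have : 0 ≤ T * L ^ 2 / (2 * ((st T).length : ℝ) * lam) := by positivity
      linarith)
  by_cases hs : (st t).Saturated
  · have hl : (st T).length = (st t).length := by rw [State.length, State.length, hsat hs]
    have hk2 := rankBound_le_of_saturated hl₀ hs
    rw [← hl] at hk1 hk2
    have hk1' : 2 * ((st T).length : ℝ) ≤ (st t).rankBound := by exact_mod_cast hk1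
    have hk2' : ((st t).rankBound : ℝ) ≤ 2 * (2 * (st T).length) := by exact_mod_cast hk2
    calc _ ≤ (2 * (2 * ((st T).length : ℝ))) *
          Real.log (1 + T * L ^ 2 / (2 * ((st T).length : ℝ) * lam)) := by
          refine mul_le_mul hk2' ?_ (Real.log_nonneg ?_) (by positivity)
          · gcongr
          · have : 0 ≤ t * L ^ 2 / ((st t).rankBound * lam) := by positivity
            linarith
      _ = _ := by ring
  · have hk : ((st t).rankBound : ℝ) ≤ 2 * (st T).length := by
      have : (st t).length ≤ (st T).length :=
        Nat.mul_le_mul_right _ (Nat.pow_le_pow_right (by norm_num) hB)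
      rw [State.rankBound, if_neg hs]
      exact_mod_cast (by omega : 2 * (st t).length ≤ 2 * (st T).length)
    have h1 := mul_log_one_add_div_le (a := T * L ^ 2 / lam) (by positivity) hkpos.le hk
    rw [div_div, div_div, mul_comm lam, mul_comm lam] at h1
    calc _ ≤ (st t).rankBound * Real.log (1 + T * L ^ 2 / ((st t).rankBound * lam)) := by gcongr
      _ ≤ _ := h1
      _ ≤ _ := le_mul_of_one_le_left (mul_nonneg (by positivity) hlog0) one_le_two

theorem GramInv.dim_log_le {t : ℕ} {st : State d l₀} (h : GramInv ε x t st)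
    (hlam : 0 < lam) :
    d * Real.log (1 + st.totalShrink / lam) ≤ 2 * (d * Real.log (1 + ε / lam)) := by
  have h0 := h.one_le hlam
  have h2 : Real.log (1 + st.totalShrink / lam) ≤ 2 * Real.log (1 + ε / lam) := by
    have h3 : 2 * Real.log (1 + ε / lam) = Real.log ((1 + ε / lam) ^ 2) := by
      rw [Real.log_pow]; norm_num
    rw [h3]
    refine Real.log_le_log (by linarith) ?_
    have h4 : st.totalShrink / lam ≤ 2 * ε / lam := by have := h.shrink_le; gcongr
    have h5 : 2 * ε / lam = 2 * (ε / lam) := by ring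
    -- This is `1 + 2y ≤ (1 + y)²` for `y = ε / λ`.
    nlinarith [sq_nonneg (ε / lam)]
  calc _ ≤ d * (2 * Real.log (1 + ε / lam)) := by gcongr
    _ = _ := by ring

/-- Since `L² ≥ λ`, the case `k = 1` already dominates `log (1 + T)`. This absorbs the term `log (1
/ δ) = log T` into the final bound. -/
theorem log_one_add_le_mul_log {lam L k T : ℝ} (hlam : 0 < lam) (hL : √lam ≤ L) (hk : 1 ≤ k)
    (hT : 0 ≤ T) : Real.log (1 + T) ≤ k * Real.log (1 + T * L ^ 2 / (k * lam)) := by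
  have h1 : 1 ≤ L ^ 2 / lam := by
    rw [one_le_div hlam, ← Real.sq_sqrt hlam.le]
    exact pow_le_pow_left₀ (Real.sqrt_nonneg _) hL 2
  have h2 := mul_log_one_add_div_le (a := T * L ^ 2 / lam) (by positivity) zero_le_one hk
  rw [one_mul, div_one, div_div, mul_comm lam] at h2
  refine le_trans (Real.log_le_log (by positivity) ?_) h2
  rw [mul_div_assoc]
  nlinarith

theorem IsRun.instant_regret_le {θ : E d} {z : ℕ → ℝ}
    (h : IsRun ε lam L H R δ T 𝒳 x (fun t => inner ℝ (x t) θ + z t) st) (hε : 0 ≤ ε)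
    (hl₀ : 1 ≤ l₀) (hlam : 0 < lam) (hR : 0 ≤ R) (hθ : ‖θ‖ ≤ H)
    (hL : ∀ t < T, ∀ y ∈ 𝒳 t, ‖y‖ ≤ L) {t : ℕ} (ht : t < T)
    (hz : noiseSum x z t ⬝ᵥ (designMatrix lam x t)⁻¹ *ᵥ noiseSum x z t ≤
      R ^ 2 * (2 * Real.log (1 / δ) + Real.log ((designMatrix lam x t).det / lam ^ d))) :
    (⨆ y : 𝒳 t, inner ℝ (y : E d) θ) - inner ℝ (x t) θ ≤
      2 * ((st t).radius lam L H R δ t *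
        weightedNorm ((st t).covariance lam)⁻¹ (x t)) := by
  have hconf := (h.gramInv hε hl₀ ht.le).abs_inner_estimate_sub_le hlam
    (fun s hs => hL s (by omega) _ (h.mem s (by omega))) hR hθ hz
  have : Nonempty (𝒳 t) := ⟨⟨x t, h.mem t ht⟩⟩
  rw [sub_le_iff_le_add]
  refine ciSup_le fun y => ?_
  -- Optimism: the true value of `y` is at most its index, which is at most that of `x t`, which
  -- exceeds the true value of `x t` by at most two widths.
  have h1 := h.select t ht y.2
  simp only [Set.mem_ofPred_eq, ucb] at h1
  have h2 := abs_le.1 (hconf (y : E d))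
  have h3 := abs_le.1 (hconf (x t))
  linarith

theorem IsRun.radius_le (h : IsRun ε lam L H R δ T 𝒳 x r st) (hε : 0 ≤ ε) (hl₀ : 1 ≤ l₀)
    (hlam : 0 < lam) (hR : 0 ≤ R) (hH : 0 ≤ H) {Ψ : ℝ}
    (hΨ : Ψ = d * Real.log (1 + ε / lam) + 2 * ((st T).length : ℝ) *
      Real.log (1 + T * L ^ 2 / (2 * ((st T).length : ℝ) * lam)))
    (hδ : Real.log (1 / δ) ≤ Ψ) (hΨ0 : 1 / 2 ≤ Ψ) {t : ℕ} (ht : t ≤ T) :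
    (st t).radius lam L H R δ t ≤
      2 * √2 * (R + H * √lam) * (1 + ε / lam) * √Ψ := by
  have hinv := h.gramInv hε hl₀ ht
  have hu : 1 ≤ 1 + ε / lam := by linarith [div_nonneg hε hlam.le]
  set u := 1 + ε / lam with hu_def
  have hc : 1 + (st t).totalShrink / lam ≤ 2 * u := by
    have h4 : (st t).totalShrink / lam ≤ 2 * ε / lam := by have := hinv.shrink_le; gcongr
    have h5 : 2 * ε / lam = 2 * (ε / lam) := by ring
    linarith
  have hc0 := hinv.one_le hlam
  have hs1 := hinv.dim_log_le hlam
  have hs2 := h.rank_log_le hlam hl₀ ht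
  have hlog : 2 * Real.log (1 / δ) + d * Real.log (1 + (st t).totalShrink / lam) +
      (st t).rankBound * Real.log (1 + t * L ^ 2 / ((st t).rankBound * lam)) ≤ 4 * Ψ := by
    linarith
  -- The bias term of the radius carries no `√Ψ`; this inequality supplies one.
  have hΨs : 1 ≤ √2 * √Ψ := by
    rw [← Real.sqrt_mul zero_le_two, Real.one_le_sqrt]
    linarith
  have hsu : √u ≤ u := Real.sqrt_le_left (by linarith) |>.2 (by nlinarith)
  have h1 : R * √(1 + (st t).totalShrink / lam) *
      √(2 * Real.log (1 / δ) + d * Real.log (1 + (st t).totalShrink / lam) +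
        (st t).rankBound * Real.log (1 + t * L ^ 2 / ((st t).rankBound * lam))) ≤
      2 * √2 * R * u * √Ψ := by
    calc _ ≤ R * √(2 * u) * √(4 * Ψ) := by gcongr
      _ = 2 * √2 * R * √u * √Ψ := by
        rw [Real.sqrt_mul zero_le_two, Real.sqrt_mul (by norm_num : (0 : ℝ) ≤ 4),
          show (4 : ℝ) = 2 ^ 2 by norm_num, Real.sqrt_sq zero_le_two]
        ring
      _ ≤ _ := by gcongr
  have h2 : H * ((lam + (st t).totalShrink) / √lam) ≤ 2 * √2 * (H * √lam) * u * √Ψ := by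
    have h3 : (lam + (st t).totalShrink) / √lam = √lam * (1 + (st t).totalShrink / lam) := by
      have := Real.sqrt_pos.2 hlam
      field_simp
      rw [Real.sq_sqrt hlam.le, mul_comm]
    rw [h3]
    calc _ ≤ H * (√lam * (2 * u)) := by gcongr
      _ ≤ H * (√lam * (2 * u)) * (√2 * √Ψ) := le_mul_of_one_le_right (by positivity) hΨs
      _ = _ := by ring
  rw [State.radius]
  linarith

theorem IsRun.weightedNorm_le (h : IsRun ε lam L H R δ T 𝒳 x r st) (hε : 0 ≤ ε) (hl₀ : 1 ≤ l₀)
    (hlam : 0 < lam) {t : ℕ} (ht : t ≤ T) (y : E d) :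
    weightedNorm ((st t).covariance lam)⁻¹ y ≤
      √(2 * (1 + ε / lam)) * √(y.ofLp ⬝ᵥ (designMatrix lam x t)⁻¹ *ᵥ y.ofLp) := by
  have hinv := h.gramInv hε hl₀ ht
  have hw := quadForm_nonneg (posDef_designMatrix hlam x t).inv.posSemidef y.ofLp
  have hu : 0 ≤ ε / lam := div_nonneg hε hlam.le
  rw [weightedNorm, ← Real.sqrt_mul (by positivity)]
  refine Real.sqrt_le_sqrt ((hinv.quadForm_inv_covariance_le hlam _).trans ?_)
  refine mul_le_mul_of_nonneg_right ?_ hw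
  have h4 : (st t).totalShrink / lam ≤ 2 * ε / lam := by have := hinv.shrink_le; gcongr
  have h5 : 2 * ε / lam = 2 * (ε / lam) := by ring
  linarith

theorem sum_sqrt_quadForm_le (hlam : 0 < lam) (hLlam : √lam ≤ L) (hL : ∀ t < T, ‖x t‖ ≤ L) :
    ∑ t ∈ Finset.range T, √((x t).ofLp ⬝ᵥ (designMatrix lam x t)⁻¹ *ᵥ (x t).ofLp) ≤
      √T * (L / √lam * √(2 * Real.log ((designMatrix lam x T).det / lam ^ d))) := by
  have hsl := Real.sqrt_pos.2 hlam
  have hL0 : 0 ≤ L := hsl.le.trans hLlam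
  have h1 : 1 ≤ L ^ 2 / lam := by
    rw [one_le_div hlam, ← Real.sq_sqrt hlam.le]
    exact pow_le_pow_left₀ hsl.le hLlam 2
  set w := fun t => (x t).ofLp ⬝ᵥ (designMatrix lam x t)⁻¹ *ᵥ (x t).ofLp with hw
  have hw0 : ∀ t, 0 ≤ w t := fun t =>
    quadForm_nonneg (posDef_designMatrix hlam x t).inv.posSemidef _
  -- The potential lemma bounds truncated terms only. As `w t ≤ L² / λ` and `L² / λ ≥ 1`, undoing
  -- the truncation costs the factor `L² / λ`.
  have hwL : ∀ t < T, w t ≤ L ^ 2 / lam * min 1 (w t) := fun t ht => by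
    have h2 : w t ≤ L ^ 2 / lam := by
      refine (quadForm_inv_le_of_smul_le (posDef_designMatrix hlam x t) hlam (fun u => ?_) _).trans
        ?_
      · rw [quadForm_designMatrix]
        linarith [Finset.sum_nonneg fun s (_ : s ∈ Finset.range t) =>
          sq_nonneg ((x s).ofLp ⬝ᵥ u)]
      · rw [dotProduct_ofLp_self]
        have := hL t ht
        gcongr
    rcases le_total 1 (w t) with h3 | h3
    · rwa [min_eq_left h3, mul_one]
    · rw [min_eq_right h3]
      exact le_mul_of_one_le_left (hw0 t) h1
  have h2 : ∑ t ∈ Finset.range T, w t ≤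
      L ^ 2 / lam * (2 * Real.log ((designMatrix lam x T).det / lam ^ d)) := by
    refine (Finset.sum_le_sum fun t ht => hwL t (Finset.mem_range.1 ht)).trans ?_
    rw [← Finset.mul_sum]
    exact mul_le_mul_of_nonneg_left (sum_min_le_log_det hlam x T) (by positivity)
  have h3 : L / √lam * √(2 * Real.log ((designMatrix lam x T).det / lam ^ d)) =
      √(L ^ 2 / lam * (2 * Real.log ((designMatrix lam x T).det / lam ^ d))) := by
    rw [Real.sqrt_mul (x := L ^ 2 / lam) (by positivity), Real.sqrt_div (sq_nonneg L), Real.sqrt_sq hL0]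
  rw [h3, ← Real.sqrt_mul (Nat.cast_nonneg T)]
  refine Real.le_sqrt_of_sq_le ?_
  have h4 := sq_sum_le_card_mul_sum_sq (s := Finset.range T) (f := fun t => √(w t))
  simp only [Real.sq_sqrt (hw0 _), Finset.card_range] at h4
  exact h4.trans (mul_le_mul_of_nonneg_left h2 (Nat.cast_nonneg T))

/-- The regret bound on the event that the self-normalized bound holds. -/
theorem IsRun.regret_le {θ : E d} {z : ℕ → ℝ}
    (h : IsRun ε lam L H R (1 / T) T 𝒳 x (fun t => inner ℝ (x t) θ + z t) st) (hε : 0 ≤ ε)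
    (hl₀ : 1 ≤ l₀) (hT : 1 ≤ T) (hlam : 0 < lam) (hLlam : √lam ≤ L) (hR : 0 ≤ R) (hθ : ‖θ‖ ≤ H)
    (hL : ∀ t < T, ∀ y ∈ 𝒳 t, ‖y‖ ≤ L)
    (hz : ∀ t ≤ T, noiseSum x z t ⬝ᵥ (designMatrix lam x t)⁻¹ *ᵥ noiseSum x z t ≤
      R ^ 2 * (2 * Real.log T + Real.log ((designMatrix lam x t).det / lam ^ d))) :
    regret T 𝒳 x θ ≤ 16 * (L * (R + H * √lam) / √lam *
      (d * Real.log (1 + ε / lam) + 2 * ((st T).length : ℝ) *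
        Real.log (1 + T * L ^ 2 / (2 * ((st T).length : ℝ) * lam))) *
      (1 + ε / lam) ^ (3 / 2 : ℝ) * √T) := by
  have hH : 0 ≤ H := (norm_nonneg θ).trans hθ
  have hsl := Real.sqrt_pos.2 hlam
  have hL0 : 0 ≤ L := hsl.le.trans hLlam
  have hT' : (1 : ℝ) ≤ T := by exact_mod_cast hT
  have hu : 1 ≤ 1 + ε / lam := by linarith [div_nonneg hε hlam.le]
  have hxL : ∀ t < T, ‖x t‖ ≤ L := fun t ht => hL t ht _ (h.mem t ht)
  obtain ⟨Ψ, hΨ⟩ : ∃ Ψ, Ψ = d * Real.log (1 + ε / lam) + 2 * ((st T).length : ℝ) *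
    Real.log (1 + T * L ^ 2 / (2 * ((st T).length : ℝ) * lam)) := ⟨_, rfl⟩
  have hlen : (1 : ℝ) ≤ (st T).length := by
    exact_mod_cast (Nat.mul_pos (by positivity) hl₀ : 0 < 2 ^ (st T).B * l₀)
  have hlogΨ : Real.log (1 + T) ≤ Ψ := by
    have h1 := log_one_add_le_mul_log hlam hLlam (k := 2 * ((st T).length : ℝ)) (by linarith)
      (by linarith : (0 : ℝ) ≤ T)
    have h2 : 0 ≤ d * Real.log (1 + ε / lam) := mul_nonneg (by positivity) (Real.log_nonneg hu)
    linarith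
  have hδΨ : Real.log (1 / (1 / (T : ℝ))) ≤ Ψ := by
    rw [one_div_one_div]
    exact (Real.log_le_log (by linarith) (by linarith)).trans hlogΨ
  -- From `T ≥ 1`, `Ψ ≥ log 2 > 1 / 2`.
  have hΨ0 : 1 / 2 ≤ Ψ := by
    have h1 : Real.log 2 ≤ Real.log (1 + T) := Real.log_le_log (by norm_num) (by linarith)
    linarith [Real.log_two_gt_d9]
  have hround : ∀ t < T, (⨆ y : 𝒳 t, inner ℝ (y : E d) θ) - inner ℝ (x t) θ ≤
      2 * (2 * √2 * (R + H * √lam) * (1 + ε / lam) * √Ψ * √(2 * (1 + ε / lam))) *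
        √((x t).ofLp ⬝ᵥ (designMatrix lam x t)⁻¹ *ᵥ (x t).ofLp) := fun t ht => by
    refine (h.instant_regret_le hε hl₀ hlam hR hθ hL ht ?_).trans ?_
    · rw [one_div_one_div]
      exact hz t ht.le
    · have h1 := h.radius_le hε hl₀ hlam hR hH hΨ hδΨ hΨ0 ht.le
      have h2 := h.weightedNorm_le hε hl₀ hlam ht.le (x t)
      have h3 := mul_le_mul h1 h2 (Real.sqrt_nonneg _) (by positivity)
      linarith
  have hdet : Real.log ((designMatrix lam x T).det / lam ^ d) ≤ 2 * Ψ := by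
    have hinv := h.gramInv hε hl₀ le_rfl
    have h1 := hinv.log_det_designMatrix_le hlam hxL
    have h2 := hinv.dim_log_le hlam
    have h3 := h.rank_log_le hlam hl₀ le_rfl
    linarith
  have hsum := sum_sqrt_quadForm_le hlam hLlam hxL
  have hpow : (1 + ε / lam) ^ (3 / 2 : ℝ) = (1 + ε / lam) * √(1 + ε / lam) := by
    rw [Real.sqrt_eq_rpow, show (3 / 2 : ℝ) = 1 + 1 / 2 by norm_num,
      Real.rpow_add (by linarith), Real.rpow_one]
  rw [← hΨ, hpow]
  set u := 1 + ε / lam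
  calc regret T 𝒳 x θ
      ≤ ∑ t ∈ Finset.range T, 2 * (2 * √2 * (R + H * √lam) * u * √Ψ * √(2 * u)) *
        √((x t).ofLp ⬝ᵥ (designMatrix lam x t)⁻¹ *ᵥ (x t).ofLp) :=
        Finset.sum_le_sum fun t ht => hround t (Finset.mem_range.1 ht)
    _ = 2 * (2 * √2 * (R + H * √lam) * u * √Ψ * √(2 * u)) * ∑ t ∈ Finset.range T,
        √((x t).ofLp ⬝ᵥ (designMatrix lam x t)⁻¹ *ᵥ (x t).ofLp) := by rw [Finset.mul_sum]
    -- The constant is `2 * 2√2 * √2 * √4 = 16`: optimism, radius, change of norm, and `√(2 * 2Ψ)`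
    -- from the potential.
    _ ≤ 2 * (2 * √2 * (R + H * √lam) * u * √Ψ * √(2 * u)) *
        (√T * (L / √lam * √(2 * (2 * Ψ)))) := by
        gcongr
        refine hsum.trans ?_
        gcongr
    _ = 8 * (√2 * √2) * (√Ψ * √Ψ) * (L * (R + H * √lam) / √lam * (u * √u) * √T) := by
        rw [Real.sqrt_mul zero_le_two u, ← mul_assoc 2 2 Ψ, Real.sqrt_mul (by norm_num),
          Real.sqrt_mul_self zero_le_two]
        ring
    _ = 16 * (L * (R + H * √lam) / √lam * Ψ * (u * √u) * √T) := by
        rw [Real.mul_self_sqrt zero_le_two, Real.mul_self_sqrt (by linarith)]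
        ring

end Regret

end DBSLinUCB

end

/-! ### The high-probability regret bound. -/

theorem mainTheorem1 : ∃ C : ℝ, 0 < C ∧
    ∀ (Ω : Type*) [mΩ : MeasurableSpace Ω] (μ : Measure Ω) [IsProbabilityMeasure μ]
      (ℱ : Filtration ℕ mΩ)
      (d l₀ T : ℕ) (ε lam L H R : ℝ) (θ : DBSLinUCB.E d)
      (𝒳 : ℕ → Ω → Set (DBSLinUCB.E d)) (x : ℕ → Ω → DBSLinUCB.E d) (z : ℕ → Ω → ℝ)
      (st : ℕ → Ω → DBSLinUCB.State d l₀),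
      1 ≤ l₀ → 1 ≤ T → 0 ≤ ε → 0 < lam → √lam ≤ L → 0 ≤ R → ‖θ‖ ≤ H →
      (∀ t < T, ∀ ω, ∀ y ∈ 𝒳 t ω, ‖y‖ ≤ L) →
      (∀ t < T, StronglyMeasurable[ℱ t] (x t)) →
      (∀ t < T, StronglyMeasurable[ℱ (t + 1)] (z t)) →
      (∀ t < T, DBSLinUCB.CondSubgaussian (ℱ t) μ R (z t)) →
      (∀ ω, DBSLinUCB.IsRun ε lam L H R (1 / T) T (fun t => 𝒳 t ω) (fun t => x t ω)
        (fun t => inner ℝ (x t ω) θ + z t ω) (fun t => st t ω)) →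
      μ {ω | C * (L * (R + H * √lam) / √lam *
            (d * Real.log (1 + ε / lam) + 2 * ((st T ω).length : ℝ) *
              Real.log (1 + T * L ^ 2 / (2 * ((st T ω).length : ℝ) * lam))) *
            (1 + ε / lam) ^ (3 / 2 : ℝ) * √T)
          < DBSLinUCB.regret T (fun t => 𝒳 t ω) (fun t => x t ω) θ}
        ≤ ENNReal.ofReal (1 / T) := by

  refine ⟨16, by norm_num, ?_⟩
  intro Ω mΩ μ _ ℱ d l₀ T ε lam L H R θ 𝒳 x z st hl₀ hT hε hlam hLlam hR hθ hL hx hz hsub hrun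
  -- The bad event is contained in the failure of the self-normalized bound; monotonicity of `μ`
  -- needs no measurability of the regret or of the sketch states.
  refine le_trans (measure_mono fun ω hω => ?_) (DBSLinUCB.measure_selfNormalized_le ℱ hlam hR hT
    (fun t ht => (hx t ht).measurable) (fun t ht => (hz t ht).measurable) hsub)
  by_contra hgood
  simp only [Set.mem_ofPred_eq, not_exists, not_and, not_lt] at hgood
  exact absurd ((hrun ω).regret_le hε hl₀ hT hlam hLlam hR hθ (fun t ht => hL t ht ω) hgood)
    (not_le.2 hω)
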